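/- **Setting.** Balls are allocated sequentially into $n$ initially empty bins. In round $t\ge 0$ a bin is chosen at random, with a distribution that may depend on the history of the first $t$ allocations, and the chosen bin receives a positive integer number of balls. Let $x_i^t$ be the load of bin $i$ after $t$ allocations, $W^t=\sum_i x_i^t$, $y_i^t=x_i^t-W^t/n$ and $\mathrm{Gap}(t)=\max_i x_i^t-W^t/n$. Bins with $y_i^t\ge 0$ are overloaded (set $B_+^t$), the others are underloaded (set $B_-^t$); $\delta^t=|B_+^t|/n$. In each round label the bins so that $x_1^t\ge\dots\ge x_n^t$ (ties broken by the process, as a function of the history), so that $B_+^t=\{1,\dots,\delta^t n\}$; let $p_i^t$ be the conditional probability, given the history, that the $(t+1)$-th allocation is to the $i$-th heaviest bin, and $P_-^t=\sum_{i\in B_-^t}p_i^t$. For vectors of equal length, $q\preceq p$ (or $p\succeq q$) means that every prefix sum of $q$ is at most the corresponding prefix sum of $p$; a scalar stands for a constant vector. **Conditions** (for every round $t\ge0$ and every history of positive probability): * $\mathcal P_1$ (constants $k_1\in\mathbb N$, $k_1\ge 1$, $k_2\in(0,1]$): $\max_{i\in B_+^t}p_i^t\le \frac{k_1}{n}$,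 $(p_1^t,\dots,p_{\delta^tn}^t)\preceq\frac1n$, $\min_{i\in B_-^t}p_i^t\ge\frac{k_2}{n}$ and $(p_n^t,\dots,p_{\delta^tn+1}^t)\succeq\frac1n$ (the conditions on underloaded bins are void if $B_-^t=\emptyset$). * $\mathcal P_2$ (constants $k_1,k_2$ as before and $k_3,k_4\in(0,1]$): the same, with the two vector conditions replaced by $(p_1^t,\dots,p_{\delta^tn}^t)\preceq\frac1n-\frac{k_3(1-\delta^t)}{n}$ and $(p_n^t,\dots,p_{\delta^tn+1}^t)\succeq\frac1n+\frac{k_4\delta^t}{n}$. * $\mathcal W_1$ (constant integers $1\le w_+\le w_-$): a chosen bin receives $w_+$ balls if it is overloaded and $w_-$ balls if it is underloaded. * $\mathcal W_2$: $\mathcal W_1$ with $w_+<w_-$ and, in addition, $(p_n^t,\dots,p_{\delta^tn+1}^t)\succeq\frac{P_-^t}{|B_-^t|}$. * $\mathcal P_3$ (a function $c:(0,\frac12)\to(0,1]$): for every $\varepsilon\in(0,\frac12)$, if $\delta^t\in[\varepsilon,1-\varepsilon]$ then $\min_{i\in[n]}p_i^t\ge\frac{c(\varepsilon)}{n}$.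 **Theorem 3.2.** Fix the constants $k_1,k_2,k_3,k_4,w_+,w_-$ and the function $c$, none of them depending on $n$. Then there are a constant $\kappa>0$ and an $n_0$, depending only on these, such that for every $n\ge n_0$ and every process on $n$ bins which satisfies $\mathcal P_2$ and $\mathcal W_1$, or $\mathcal P_1$ and $\mathcal W_2$, and which also satisfies $\mathcal P_3$ (with these constants), $$\Pr\big[\mathrm{Gap}(\lfloor\kappa n\log n\rfloor)\ge\kappa\log n\big]\ge 1-n^{-1/2}.$$ -/

import Mathlib

/-- The load vector after a sequence of allocations. A history is the list of the bins chosen so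
far, the most recent one first; `weight h i` is the number of balls that are allocated to bin `i`
if bin `i` is chosen right after the history `h`. All bins are empty at the beginning. -/
def loadVec {n : ℕ} (weight : List (Fin n) → Fin n → ℕ) : List (Fin n) → Fin n → ℕ
  | [] => fun _ => 0
  | i :: h => fun j => loadVec weight h j + if j = i then weight h i else 0

/-- A sequential process allocating balls into `n` bins. Given the history `h` of the allocations
made so far, the next bin is drawn from the distribution `nextBin h` and receives
`weight h i` balls, `i` being the bin drawn. The permutation `order h` lists the bins by
non-increasing load (`order h 0` is a heaviest bin); the process may break ties as it likes. -/
structure AllocationProcess (n : ℕ) where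
  nextBin : List (Fin n) → PMF (Fin n)
  weight : List (Fin n) → Fin n → ℕ
  order : List (Fin n) → Equiv.Perm (Fin n)
  order_antitone : ∀ h, Antitone fun k => loadVec weight h (order h k)

/-- `p` majorizes `q`: every prefix sum of `p` is at least the corresponding prefix sum of `q`. -/
def Majorizes {N : ℕ} (p q : Fin N → ℝ) : Prop :=
  ∀ k ≤ N, ∑ i : Fin N with i.val < k, q i ≤ ∑ i : Fin N with i.val < k, p i

namespace AllocationProcess

noncomputable section

variable {n : ℕ} (P : AllocationProcess n)

/-- The law of the history of the first `t` allocations. -/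
def law : ℕ → PMF (List (Fin n))
  | 0 => PMF.pure []
  | t + 1 => (law t).bind fun h => (P.nextBin h).map fun i => i :: h

/-- The probability of the event `E` about the first `t` allocations. -/
def pr (t : ℕ) (E : Set (List (Fin n))) : ℝ := ((P.law t).toOuterMeasure E).toReal

/-- `h` is a possible history: it has positive probability. -/
def Possible (h : List (Fin n)) : Prop := ∃ t, h ∈ (P.law t).support

/-- The load `x_i` of bin `i`. -/
def load (h : List (Fin n)) (i : Fin n) : ℕ := loadVec P.weight h i

/-- The total number `W` of balls allocated. -/
def total (h : List (Fin n)) : ℕ := ∑ i, P.load h i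

/-- The normalized load `y_i = x_i - W / n`. -/
def normLoad (h : List (Fin n)) (i : Fin n) : ℝ := P.load h i - (P.total h : ℝ) / n

/-- The gap: maximum load minus mean load. -/
def gap (h : List (Fin n)) : ℝ := (⨆ i, (P.load h i : ℝ)) - (P.total h : ℝ) / n

/-- The set of overloaded bins. -/
def overloaded (h : List (Fin n)) : Finset (Fin n) := {i | 0 ≤ P.normLoad h i}

/-- The set of underloaded bins. -/
def underloaded (h : List (Fin n)) : Finset (Fin n) := {i | P.normLoad h i < 0}

/-- The mean quantile: the fraction of overloaded bins. -/
def quantile (h : List (Fin n)) : ℝ := ((P.overloaded h).card : ℝ) / n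

/-- The probability that the next allocation is to bin `i`. -/
def binProb (h : List (Fin n)) (i : Fin n) : ℝ := (P.nextBin h i).toReal

/-- The probability allocation vector: entry `k` is the probability that the next allocation is
to the `k`-th heaviest bin (counted from `0`). -/
def probVec (h : List (Fin n)) (k : Fin n) : ℝ := P.binProb h (P.order h k)

/-- The probability that the next allocation is to an underloaded bin. -/
def underProb (h : List (Fin n)) : ℝ := ∑ i ∈ P.underloaded h, P.binProb h i

theorem card_overloaded_le (h : List (Fin n)) : (P.overloaded h).card ≤ n :=
  card_finset_fin_le _

theorem card_underloaded_le (h : List (Fin n)) : (P.underloaded h).card ≤ n :=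
  card_finset_fin_le _

/-- The part of the probability allocation vector that belongs to the overloaded bins, from the
heaviest bin on: `(p_1, …, p_{δn})`. -/
def overVec (h : List (Fin n)) (k : Fin (P.overloaded h).card) : ℝ :=
  P.probVec h (Fin.castLE (P.card_overloaded_le h) k)

/-- The part of the probability allocation vector that belongs to the underloaded bins, from the
lightest bin on: `(p_n, …, p_{δn+1})`. -/
def underVec (h : List (Fin n)) (k : Fin (P.underloaded h).card) : ℝ :=
  P.probVec h (Fin.castLE (P.card_underloaded_le h) k).rev

/-- Condition `P₁` with constants `k₁`, `k₂`. -/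
structure CondP1 (k₁ : ℕ) (k₂ : ℝ) : Prop where
  over_le : ∀ h, P.Possible h → ∀ i ∈ P.overloaded h, P.binProb h i ≤ k₁ / n
  over_maj : ∀ h, P.Possible h → Majorizes (fun _ => 1 / (n : ℝ)) (P.overVec h)
  le_under : ∀ h, P.Possible h → ∀ i ∈ P.underloaded h, k₂ / n ≤ P.binProb h i
  under_maj : ∀ h, P.Possible h → Majorizes (P.underVec h) (fun _ => 1 / (n : ℝ))

/-- Condition `P₂` (probability bias) with constants `k₁`, `k₂`, `k₃`, `k₄`. -/
structure CondP2 (k₁ : ℕ) (k₂ k₃ k₄ : ℝ) : Prop where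
  over_le : ∀ h, P.Possible h → ∀ i ∈ P.overloaded h, P.binProb h i ≤ k₁ / n
  over_maj : ∀ h, P.Possible h →
    Majorizes (fun _ => 1 / (n : ℝ) - k₃ * (1 - P.quantile h) / n) (P.overVec h)
  le_under : ∀ h, P.Possible h → ∀ i ∈ P.underloaded h, k₂ / n ≤ P.binProb h i
  under_maj : ∀ h, P.Possible h →
    Majorizes (P.underVec h) (fun _ => 1 / (n : ℝ) + k₄ * P.quantile h / n)

/-- Condition `W₁` with weights `wPlus` (overloaded bins) and `wMinus` (underloaded bins). -/
structure CondW1 (wPlus wMinus : ℕ) : Prop where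
  one_le : 1 ≤ wPlus
  le : wPlus ≤ wMinus
  weight_over : ∀ h, P.Possible h → ∀ i ∈ P.overloaded h, P.weight h i = wPlus
  weight_under : ∀ h, P.Possible h → ∀ i ∈ P.underloaded h, P.weight h i = wMinus

/-- Condition `W₂` (weight bias) with weights `wPlus` and `wMinus`. -/
structure CondW2 (wPlus wMinus : ℕ) : Prop extends P.CondW1 wPlus wMinus where
  lt : wPlus < wMinus
  under_maj : ∀ h, P.Possible h →
    Majorizes (P.underVec h) (fun _ => P.underProb h / (P.underloaded h).card)

/-- Condition `P₃`: whenever the mean quantile is in `[ε, 1 - ε]`, every bin has probability at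
least `c ε / n`. -/
def CondP3 (c : ℝ → ℝ) : Prop :=
  ∀ ε ∈ Set.Ioo (0 : ℝ) (1 / 2), ∀ h, P.Possible h → P.quantile h ∈ Set.Icc ε (1 - ε) →
    ∀ k, c ε / n ≤ P.probVec h k

end

end AllocationProcess

/-! Write L = log n and T = ⌊κnL⌋, and let M be (w₋ + 1)κL rounded up. The mean load after T rounds
is at most w₋κL, so one bin of load at least M already gives gap κL. It remains to show that all
loads stay below M with probability at most 2/n.

Call a round balanced if its quantile lies in [ε, 1 - ε]. Such a round serves every bin with
probability at least c(ε)/n. If γT rounds are balanced, the loads can be compared with independent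
binomials whose mean is of order κL (`pr_le_binomialBelow_pow`). The ratio of this mean to M is
bounded below independently of κ, so for small κ one binomial reaches M with probability at least
n^(-1/2), and n of them all fail with probability at most exp(-√n).

Balanced rounds are frequent because of a potential F (`exists_potential`). It is at least -n,
starts at O(n), and its drift is at most -1/2 in an unbalanced round and at most a constant D in a
balanced one. While all loads are below M = O(log n), its increments have bounds of order M, so an
exponential supermartingale (`pr_goodCount_lt_le`) rules out fewer than γT balanced rounds.

F has four terms; let s be the total overload divided by n and δ the quantile. The sum of squares
has drift at most -2ks + O(1), which wins when s is large. If δ < ε and s is bounded, a constant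
fraction of the bins is only slightly underloaded; each is hit with probability at least k₂/n, and
by convexity a sum of capped exponentials grows in spite of the rising mean. `lowPotential` uses its
negative. If δ > 1 - ε, the squared deficits have drift at most -ks + O(ε + 1/n), which wins unless
s is tiny; if s is tiny, most bins lie in [0, 1/8] and sink in every round, so the sum of
`clampLoad` falls. The two alternative hypotheses enter the construction only through `BiasedStep`.
-/

open Finset

/-! ### Majorization -/

/-- Summation by parts. In the induction the sum before the last entry is nonnegative, so its factor
may be lowered from the second last value of `z` to the last. The sign of the full sum plays no
role. -/
theorem last_mul_sum_le_sum_mul {N : ℕ} (d z : Fin (N + 1) → ℝ) (hz : Antitone z)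
    (hd : ∀ k ≤ N, 0 ≤ ∑ i : Fin (N + 1) with i.val < k, d i) :
    z (Fin.last N) * ∑ i, d i ≤ ∑ i, d i * z i := by
  induction N with
  | zero => simp [mul_comm]
  | succ N ih =>
    have key : ∀ k ≤ N + 1, ∑ i : Fin (N + 2) with i.val < k, d i =
        ∑ i : Fin (N + 1) with i.val < k, d i.castSucc := by
      intro k hk
      have : ¬ (N + 1 < k) := by omega
      rw [sum_filter, Fin.sum_univ_castSucc, sum_filter]
      simp [this]
    have h1 := ih (fun i => d i.castSucc) (fun i => z i.castSucc)
      (fun i j hij => hz (by simpa using hij))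
      (fun k hk => by rw [← key k (by omega)]; exact hd k (by omega))
    have h2 : 0 ≤ ∑ i : Fin (N + 1), d i.castSucc := by
      have := hd (N + 1) le_rfl
      rw [key _ le_rfl] at this
      rwa [filter_true_of_mem (fun i _ => i.2)] at this
    have h3 : z (Fin.last (N + 1)) ≤ z (Fin.last N).castSucc := hz (Fin.le_last _)
    rw [Fin.sum_univ_castSucc, Fin.sum_univ_castSucc (fun i => d i * z i)]
    nlinarith [mul_le_mul_of_nonneg_right h3 h2]

/-- The vectors compared later are only parts of a probability vector, so their totals may differ.
The surplus is multiplied by the smallest value of `z`, which is why `z` must be nonnegative. -/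
theorem Majorizes.sum_mul_le {N : ℕ} {p q : Fin N → ℝ} (h : Majorizes p q) {z : Fin N → ℝ}
    (hz : Antitone z) (h0 : ∀ i, 0 ≤ z i) : ∑ i, q i * z i ≤ ∑ i, p i * z i := by
  cases N with
  | zero => simp
  | succ N =>
    have h1 : ∀ k ≤ N + 1, 0 ≤ ∑ i : Fin (N + 1) with i.val < k, (p i - q i) := fun k hk => by
      rw [sum_sub_distrib]; exact sub_nonneg.2 (h k hk)
    have h2 := last_mul_sum_le_sum_mul (fun i => p i - q i) z hz (fun k hk => h1 k (by omega))
    have h3 := h1 (N + 1) le_rfl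
    rw [filter_true_of_mem (fun i _ => i.2)] at h3
    have h4 := mul_nonneg (h0 (Fin.last N)) h3
    simp only [sub_mul, sum_sub_distrib] at h2 h4
    linarith

namespace AllocationProcess

variable {n : ℕ} (P : AllocationProcess n)

/-! ### One step of an allocation process -/

theorem binProb_nonneg (h : List (Fin n)) (i : Fin n) : 0 ≤ P.binProb h i := ENNReal.toReal_nonneg

theorem sum_binProb (h : List (Fin n)) : ∑ i, P.binProb h i = 1 := by
  have := (P.nextBin h).tsum_coe
  rw [tsum_fintype] at this
  unfold binProb
  rw [← ENNReal.toReal_sum (fun i _ => (P.nextBin h).apply_ne_top i), this, ENNReal.toReal_one]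

theorem load_cons (i : Fin n) (h : List (Fin n)) (j : Fin n) :
    P.load (i :: h) j = P.load h j + if j = i then P.weight h i else 0 := rfl

theorem total_cons (i : Fin n) (h : List (Fin n)) :
    P.total (i :: h) = P.total h + P.weight h i := by
  simp [total, load_cons, sum_add_distrib]

theorem normLoad_cons (i : Fin n) (h : List (Fin n)) (j : Fin n) :
    P.normLoad (i :: h) j =
      P.normLoad h j - P.weight h i / n + if j = i then (P.weight h i : ℝ) else 0 := by
  simp only [normLoad, load_cons, total_cons]
  push_cast
  split_ifs <;> ring

theorem normLoad_nil (j : Fin n) : P.normLoad [] j = 0 := by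
  simp [normLoad, total, load, loadVec]

theorem sum_normLoad (hn : 0 < n) (h : List (Fin n)) : ∑ j, P.normLoad h j = 0 := by
  have : (n : ℝ) ≠ 0 := by positivity
  simp only [normLoad, sum_sub_distrib, sum_const, card_univ, Fintype.card_fin, nsmul_eq_mul, total]
  push_cast
  field_simp
  ring

theorem antitone_normLoad_order (h : List (Fin n)) :
    Antitone fun k => P.normLoad h (P.order h k) := by
  intro a b hab
  have : P.load h (P.order h b) ≤ P.load h (P.order h a) := P.order_antitone h hab
  simp only [normLoad]
  have : (P.load h (P.order h b) : ℝ) ≤ P.load h (P.order h a) := by exact_mod_cast this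
  linarith

theorem order_mem_overloaded (h : List (Fin n)) (k : Fin n) (hk : k.val < (P.overloaded h).card) :
    P.order h k ∈ P.overloaded h := by
  by_contra hc
  have hneg : P.normLoad h (P.order h k) < 0 := by simpa [overloaded] using hc
  have hsub : P.overloaded h ⊆ (Finset.Iio k).map (P.order h).toEmbedding := by
    intro i hi
    obtain ⟨j, rfl⟩ := (P.order h).surjective i
    simp only [mem_map_equiv, Equiv.symm_apply_apply, mem_Iio]
    by_contra hj
    have h1 : P.normLoad h (P.order h j) ≤ P.normLoad h (P.order h k) :=
      P.antitone_normLoad_order h (not_lt.1 hj)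
    have h2 : 0 ≤ P.normLoad h (P.order h j) := by simpa [overloaded] using hi
    linarith
  have := card_le_card hsub
  rw [card_map, Fin.card_Iio] at this
  omega

theorem order_rev_mem_underloaded (h : List (Fin n)) (k : Fin n)
    (hk : k.val < (P.underloaded h).card) : P.order h k.rev ∈ P.underloaded h := by
  by_contra hc
  have hpos : 0 ≤ P.normLoad h (P.order h k.rev) := by simpa [underloaded] using hc
  have hsub : P.underloaded h ⊆ (Finset.Ioi k.rev).map (P.order h).toEmbedding := by
    intro i hi
    obtain ⟨j, rfl⟩ := (P.order h).surjective i
    simp only [mem_map_equiv, Equiv.symm_apply_apply, mem_Ioi]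
    by_contra hj
    have h1 : P.normLoad h (P.order h k.rev) ≤ P.normLoad h (P.order h j) :=
      P.antitone_normLoad_order h (not_lt.1 hj)
    have h2 : P.normLoad h (P.order h j) < 0 := by simpa [underloaded] using hi
    linarith
  have := card_le_card hsub
  rw [card_map, Fin.card_Ioi, Fin.val_rev] at this
  omega

theorem sum_overloaded_eq (h : List (Fin n)) (f : Fin n → ℝ) :
    ∑ i ∈ P.overloaded h, f i =
      ∑ k : Fin (P.overloaded h).card, f (P.order h (Fin.castLE (P.card_overloaded_le h) k)) := by
  have hinj : Function.Injective fun k : Fin (P.overloaded h).card =>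
      P.order h (Fin.castLE (P.card_overloaded_le h) k) :=
    (P.order h).injective.comp (Fin.castLE_injective _)
  have himg : univ.image (fun k : Fin (P.overloaded h).card =>
      P.order h (Fin.castLE (P.card_overloaded_le h) k)) = P.overloaded h := by
    refine eq_of_subset_of_card_le ?_ ?_
    · intro i hi
      obtain ⟨k, -, rfl⟩ := mem_image.1 hi
      exact P.order_mem_overloaded h _ k.2
    · rw [card_image_of_injective _ hinj]; simp
  conv_lhs => rw [← himg]
  rw [sum_image (fun a _ b _ hab => hinj hab)]

theorem sum_underloaded_eq (h : List (Fin n)) (f : Fin n → ℝ) :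
    ∑ i ∈ P.underloaded h, f i =
      ∑ k : Fin (P.underloaded h).card,
        f (P.order h (Fin.castLE (P.card_underloaded_le h) k).rev) := by
  have hinj : Function.Injective fun k : Fin (P.underloaded h).card =>
      P.order h (Fin.castLE (P.card_underloaded_le h) k).rev :=
    (P.order h).injective.comp (Fin.rev_injective.comp (Fin.castLE_injective _))
  have himg : univ.image (fun k : Fin (P.underloaded h).card =>
      P.order h (Fin.castLE (P.card_underloaded_le h) k).rev) = P.underloaded h := by
    refine eq_of_subset_of_card_le ?_ ?_
    · intro i hi
      obtain ⟨k, -, rfl⟩ := mem_image.1 hi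
      exact P.order_rev_mem_underloaded h _ k.2
    · rw [card_image_of_injective _ hinj]; simp
  conv_lhs => rw [← himg]
  rw [sum_image (fun a _ b _ hab => hinj hab)]

theorem sum_overloaded_le_of_majorizes {h : List (Fin n)} {α : ℝ}
    (hm : Majorizes (fun _ => α) (P.overVec h)) {φ : ℝ → ℝ} (hφ : MonotoneOn φ (Set.Ici 0))
    (h0 : ∀ r, 0 ≤ r → 0 ≤ φ r) :
    ∑ i ∈ P.overloaded h, P.binProb h i * φ (P.normLoad h i) ≤
      α * ∑ i ∈ P.overloaded h, φ (P.normLoad h i) := by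
  rw [sum_overloaded_eq, sum_overloaded_eq, mul_sum]
  have hnn : ∀ k : Fin (P.overloaded h).card,
      0 ≤ P.normLoad h (P.order h (Fin.castLE (P.card_overloaded_le h) k)) := fun k => by
    simpa [overloaded] using P.order_mem_overloaded h (Fin.castLE (P.card_overloaded_le h) k) k.2
  exact hm.sum_mul_le
    (z := fun k => φ (P.normLoad h (P.order h (Fin.castLE (P.card_overloaded_le h) k))))
    (fun a b hab => hφ (hnn b) (hnn a) (P.antitone_normLoad_order h (by simpa using hab)))
    (fun k => h0 _ (hnn k))

theorem le_sum_underloaded_of_majorizes {h : List (Fin n)} {α : ℝ}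
    (hm : Majorizes (P.underVec h) (fun _ => α)) {φ : ℝ → ℝ} (hφ : MonotoneOn φ (Set.Ici 0))
    (h0 : ∀ r, 0 ≤ r → 0 ≤ φ r) :
    α * ∑ i ∈ P.underloaded h, φ (-P.normLoad h i) ≤
      ∑ i ∈ P.underloaded h, P.binProb h i * φ (-P.normLoad h i) := by
  rw [sum_underloaded_eq, sum_underloaded_eq, mul_sum]
  have hnn : ∀ k : Fin (P.underloaded h).card,
      0 ≤ -P.normLoad h (P.order h (Fin.castLE (P.card_underloaded_le h) k).rev) := fun k => by
    have := P.order_rev_mem_underloaded h (Fin.castLE (P.card_underloaded_le h) k) k.2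
    simp only [underloaded, mem_filter, mem_univ, true_and] at this
    exact (neg_pos.2 this).le
  refine hm.sum_mul_le
    (z := fun k => φ (-P.normLoad h (P.order h (Fin.castLE (P.card_underloaded_le h) k).rev)))
    (fun a b hab => hφ (hnn b) (hnn a) (neg_le_neg (P.antitone_normLoad_order h ?_)))
    (fun k => h0 _ (hnn k))
  simpa using hab

/-! ### Supermartingale bound -/

theorem mem_support_law_succ {t : ℕ} {h : List (Fin n)} (hh : h ∈ (P.law (t + 1)).support) :
    ∃ i h', h = i :: h' ∧ h' ∈ (P.law t).support := by
  rw [law, PMF.mem_support_bind_iff] at hh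
  obtain ⟨h', h1, h2⟩ := hh
  rw [PMF.mem_support_map_iff] at h2
  obtain ⟨i, -, rfl⟩ := h2
  exact ⟨i, h', rfl, h1⟩

theorem length_of_mem_support_law {t : ℕ} {h : List (Fin n)} (hh : h ∈ (P.law t).support) :
    h.length = t := by
  induction t generalizing h with
  | zero => simp_all [law]
  | succ t ih =>
    obtain ⟨i, h', rfl, h1⟩ := P.mem_support_law_succ hh
    simp [ih h1]

theorem tsum_law_succ (t : ℕ) (Φ : List (Fin n) → ENNReal) :
    ∑' h, P.law (t + 1) h * Φ h = ∑' h, P.law t h * ∑ i, P.nextBin h i * Φ (i :: h) := by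
  classical
  have h1 : ∀ h, P.law (t + 1) h = ∑' h', P.law t h' * ∑ i, if h = i :: h' then P.nextBin h' i else 0 := by
    intro h
    simp only [law, PMF.bind_apply, PMF.map_apply, tsum_fintype]
    congr!
  simp_rw [h1, ← ENNReal.tsum_mul_right]
  rw [ENNReal.tsum_comm]
  refine tsum_congr fun h' => ?_
  simp_rw [mul_assoc]
  rw [ENNReal.tsum_mul_left]
  congr 1
  simp_rw [Finset.sum_mul]
  rw [Summable.tsum_finsetSum (fun _ _ => ENNReal.summable)]
  refine Finset.sum_congr rfl fun i _ => ?_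
  rw [tsum_eq_single (i :: h') (fun b hb => by simp [hb])]
  simp

theorem tsum_law_le (Φ : List (Fin n) → ENNReal)
    (hΦ : ∀ h, P.Possible h → ∑ i, P.nextBin h i * Φ (i :: h) ≤ Φ h) (t : ℕ) :
    ∑' h, P.law t h * Φ h ≤ Φ [] := by
  classical
  induction t with
  | zero =>
    rw [tsum_eq_single [] (fun b hb => by simp [law, hb])]
    simp [law]
  | succ t ih =>
    rw [tsum_law_succ]
    refine le_trans (ENNReal.tsum_le_tsum fun h => ?_) ih
    by_cases hh : P.law t h = 0
    · simp [hh]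
    · gcongr
      exact hΦ h ⟨t, by rwa [PMF.mem_support_iff]⟩

/-- Markov's inequality for a nonnegative supermartingale `Φ`. -/
theorem pr_le_of_supermartingale {Φ : List (Fin n) → ℝ} (h0 : ∀ h, 0 ≤ Φ h)
    (hΦ : ∀ h, P.Possible h → ∑ i, P.binProb h i * Φ (i :: h) ≤ Φ h) {t : ℕ}
    {E : Set (List (Fin n))} (hE : ∀ h ∈ E, h ∈ (P.law t).support → 1 ≤ Φ h) :
    P.pr t E ≤ Φ [] := by
  classical
  have h1 := P.tsum_law_le (fun h => ENNReal.ofReal (Φ h)) (fun h hh => by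
    refine le_trans (le_of_eq ?_) (ENNReal.ofReal_le_ofReal (hΦ h hh))
    rw [ENNReal.ofReal_sum_of_nonneg (fun i _ => mul_nonneg (P.binProb_nonneg h i) (h0 _))]
    refine sum_congr rfl fun i _ => ?_
    rw [ENNReal.ofReal_mul (P.binProb_nonneg h i), binProb,
      ENNReal.ofReal_toReal ((P.nextBin h).apply_ne_top i)]) t
  refine ENNReal.toReal_le_of_le_ofReal (h0 _) (le_trans ?_ h1)
  rw [PMF.toOuterMeasure_apply]
  refine ENNReal.tsum_le_tsum fun h => ?_
  by_cases hh : h ∈ E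
  · rw [Set.indicator_of_mem hh]
    by_cases hs : P.law t h = 0
    · simp [hs]
    · have := hE h hh (by rwa [PMF.mem_support_iff])
      calc P.law t h = P.law t h * 1 := by simp
        _ ≤ _ := by gcongr; simpa using this
  · simp [Set.indicator_of_notMem hh]

theorem one_le_pr_add_pr_add_pr {t : ℕ} {A B C : Set (List (Fin n))}
    (h : ∀ h ∈ (P.law t).support, h ∈ A ∨ h ∈ B ∨ h ∈ C) :
    1 ≤ P.pr t A + P.pr t B + P.pr t C := by
  classical
  set μ := (P.law t).toOuterMeasure
  have hle : ∀ E, μ E ≤ 1 := fun E => by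
    have := (P.law t).tsum_coe
    rw [← this, PMF.toOuterMeasure_apply]
    exact ENNReal.tsum_le_tsum fun h => Set.indicator_le_self _ _ h
  have hfin : ∀ E, μ E ≠ ⊤ := fun E => ((hle E).trans_lt ENNReal.one_lt_top).ne
  have h1 : μ (A ∪ (B ∪ C)) = 1 := by
    rw [PMF.toOuterMeasure_apply_eq_one_iff]
    exact fun x hx => h x hx
  have h2 : (1 : ENNReal) ≤ μ A + (μ B + μ C) := by
    rw [← h1]
    exact (MeasureTheory.measure_union_le _ _).trans
      (add_le_add_right (MeasureTheory.measure_union_le _ _) _)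
  have h3 := ENNReal.toReal_mono (by simp [hfin]) h2
  rw [ENNReal.toReal_add (hfin _) (by simp [hfin]), ENNReal.toReal_add (hfin _) (hfin _),
    ENNReal.toReal_one] at h3
  simp only [pr]
  linarith

end AllocationProcess

/-! ### Potential functions of the normalized load vector -/

noncomputable section

/-- The normalized load vector after bin `i` has received `x` balls. -/
def bump {n : ℕ} (y : Fin n → ℝ) (i : Fin n) (x : ℝ) : Fin n → ℝ :=
  fun j => y j - x / n + if j = i then x else 0

/-- The total overload divided by the number of bins. -/
def excess {n : ℕ} (y : Fin n → ℝ) : ℝ := (∑ i with 0 ≤ y i, y i) / n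

/-- The fraction of overloaded bins. -/
def overFrac {n : ℕ} (y : Fin n → ℝ) : ℝ := (#{i | 0 ≤ y i} : ℝ) / n

/-- The decrease of the squared deficit `r` of a bin that receives `w` balls. -/
def deficitDrop (w r : ℝ) : ℝ := r ^ 2 - (max (r - w) 0) ^ 2

/-- The properties of one allocation (normalized loads `y`, probabilities `p`, weights `x`) that
the drift estimates depend on. -/
structure BiasedStep {n : ℕ} (y p x : Fin n → ℝ) (w k₂ k : ℝ) : Prop where
  n_pos : 0 < n
  p_nonneg : ∀ i, 0 ≤ p i
  sum_p : ∑ i, p i = 1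
  sum_y : ∑ i, y i = 0
  one_le_x : ∀ i, 1 ≤ x i
  x_le : ∀ i, x i ≤ w
  x_eq : ∀ i, y i < 0 → x i = w
  le_p : ∀ i, y i < 0 → k₂ / n ≤ p i
  sum_mul_le : ∑ i, p i * (x i * y i) ≤ -k * excess y
  le_under : (∑ i with y i < 0, deficitDrop w (-y i)) / n ≤
    ∑ i with y i < 0, p i * deficitDrop w (-y i)
  high : 3 / 4 ≤ overFrac y →
    2 * (∑ i, p i * x i) * excess y - ∑ i with y i < 0, p i * deficitDrop w (-y i) ≤
      -k * excess y + 2 * w ^ 2 * (1 - overFrac y)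

theorem deficitDrop_nonneg {w r : ℝ} (hw : 0 ≤ w) (hr : 0 ≤ r) : 0 ≤ deficitDrop w r := by
  unfold deficitDrop
  have : max (r - w) 0 ≤ r := max_le (by linarith) hr
  have h0 : 0 ≤ max (r - w) 0 := le_max_right _ _
  nlinarith

theorem le_deficitDrop (w r : ℝ) : 2 * w * r - w ^ 2 ≤ deficitDrop w r := by
  unfold deficitDrop
  rcases max_cases (r - w) 0 with ⟨h, _⟩ | ⟨h, _⟩ <;> rw [h] <;> nlinarith [sq_nonneg (r - w)]

/-- Monotonicity is what allows majorization to be tested against the drop, and what makes the shift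
of the mean harmless. -/
theorem deficitDrop_le_of_le {w a b : ℝ} (hw : 0 ≤ w) (ha : 0 ≤ a) (hab : a ≤ b) :
    deficitDrop w a ≤ deficitDrop w b := by
  unfold deficitDrop
  rcases max_cases (a - w) 0 with ⟨h, h'⟩ | ⟨h, h'⟩ <;>
  rcases max_cases (b - w) 0 with ⟨g, g'⟩ | ⟨g, g'⟩ <;> rw [h, g] <;> nlinarith

theorem deficitDrop_monotoneOn {w : ℝ} (hw : 0 ≤ w) : MonotoneOn (deficitDrop w) (Set.Ici 0) :=
  fun _ ha _ _ hab => deficitDrop_le_of_le hw ha hab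

/-- Every one-coordinate potential is analysed by this split: the common shift caused by the rising
mean, then the jump of the chosen bin. -/
theorem sum_bump {n : ℕ} (f : ℝ → ℝ) (y : Fin n → ℝ) (i : Fin n) (x : ℝ) :
    ∑ j, f (bump y i x j) =
      ∑ j, f (y j - x / n) + (f (y i - x / n + x) - f (y i - x / n)) := by
  have : ∀ j, f (bump y i x j) = f (y j - x / n) +
      if j = i then f (y i - x / n + x) - f (y i - x / n) else 0 := by
    intro j
    unfold bump
    split_ifs with h
    · subst h; ring
    · simp
  simp_rw [this, sum_add_distrib]
  simp

/-! ### Excess and fraction of overloaded bins -/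

section elementary

variable {n : ℕ} {y : Fin n → ℝ}

theorem overFrac_nonneg : 0 ≤ overFrac y := by unfold overFrac; positivity

theorem excess_nonneg : 0 ≤ excess y :=
  div_nonneg (sum_nonneg fun i hi => by simpa using hi) (by positivity)

theorem card_under (hn : 0 < n) : (#{i | y i < 0} : ℝ) = n * (1 - overFrac y) := by
  have h := card_filter_add_card_filter_not (s := (univ : Finset (Fin n))) (fun i => 0 ≤ y i)
  simp only [not_le, card_univ, Fintype.card_fin] at h
  have h' : (#{i | 0 ≤ y i} : ℝ) + #{i | y i < 0} = n := by exact_mod_cast h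
  have : (n : ℝ) ≠ 0 := by positivity
  unfold overFrac
  field_simp
  linarith

theorem overFrac_le_one (hn : 0 < n) : overFrac y ≤ 1 := by
  have h1 := card_under (y := y) hn
  have h2 : (0 : ℝ) < n := by positivity
  have h3 : (0 : ℝ) ≤ #{i | y i < 0} := by positivity
  rw [h1] at h3
  have := nonneg_of_mul_nonneg_right h3 h2
  linarith

theorem sum_over_add_sum_under (f : Fin n → ℝ) :
    ∑ i with 0 ≤ y i, f i + ∑ i with y i < 0, f i = ∑ i, f i := by
  have := sum_filter_add_sum_filter_not (univ : Finset (Fin n)) (fun i => 0 ≤ y i) f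
  simpa only [not_le] using this

theorem sum_over_eq (hn : 0 < n) : ∑ i with 0 ≤ y i, y i = n * excess y := by
  have : (n : ℝ) ≠ 0 := by positivity
  unfold excess
  field_simp

theorem sum_under_eq (hn : 0 < n) (hy : ∑ i, y i = 0) :
    ∑ i with y i < 0, -y i = n * excess y := by
  have h := sum_over_add_sum_under (y := y) y
  rw [hy, sum_over_eq hn] at h
  rw [sum_neg_distrib]
  linarith

theorem excess_le (hn : 0 < n) {M : ℝ} (hM : ∀ i, |y i| ≤ M) : excess y ≤ M := by
  have h0 : (0 : ℝ) < n := by positivity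
  have h1 : n * excess y ≤ n * M := by
    rw [← sum_over_eq hn]
    have hM0 : 0 ≤ M := (abs_nonneg _).trans (hM ⟨0, hn⟩)
    calc ∑ i with 0 ≤ y i, y i ≤ ∑ i : Fin n with 0 ≤ y i, M :=
          sum_le_sum fun i _ => (le_abs_self _).trans (hM i)
      _ ≤ ∑ i : Fin n, M := sum_le_sum_of_subset_of_nonneg (filter_subset _ _) (fun _ _ _ => hM0)
      _ = n * M := by simp
  exact le_of_mul_le_mul_left h1 h0

end elementary

/-! #### The quadratic potential -/

theorem sum_sq_bump {n : ℕ} {y : Fin n → ℝ} (hn : 0 < n) (hy : ∑ i, y i = 0) (i : Fin n) (x : ℝ) :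
    ∑ j, bump y i x j ^ 2 - ∑ j, y j ^ 2 = 2 * (x * y i) + x ^ 2 - x ^ 2 / n := by
  have h0 : (n : ℝ) ≠ 0 := by positivity
  rw [sum_bump (fun z => z ^ 2)]
  have : ∑ j, (y j - x / n) ^ 2 = ∑ j, y j ^ 2 - 2 * (x / n) * ∑ j, y j + n * (x / n) ^ 2 := by
    simp_rw [sub_sq, sum_add_distrib, sum_sub_distrib, mul_sum]
    simp only [sum_const, card_univ, Fintype.card_fin, nsmul_eq_mul]
    congr 2
    exact sum_congr rfl fun j _ => by ring
  rw [this, hy]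
  field_simp
  ring

/-! #### The squared deficits -/

theorem min_sq_sub_le {z c : ℝ} (hc : 0 ≤ c) :
    (min (z - c) 0) ^ 2 ≤ (min z 0) ^ 2 + 2 * c * max (-z) 0 + c ^ 2 := by
  rcases min_cases (z - c) 0 with ⟨h, h'⟩ | ⟨h, h'⟩ <;>
  rcases min_cases z 0 with ⟨g, g'⟩ | ⟨g, g'⟩ <;>
  rcases max_cases (-z) 0 with ⟨e, e'⟩ | ⟨e, e'⟩ <;> rw [h, g, e] <;> nlinarith

theorem min_sq_antitone {a b : ℝ} (h : a ≤ b) : (min b 0) ^ 2 ≤ (min a 0) ^ 2 := by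
  have h1 : min a 0 ≤ min b 0 := min_le_min_right _ h
  have h2 : min b 0 ≤ 0 := min_le_right _ _
  nlinarith

theorem sum_min_sq_bump_le {n : ℕ} {y : Fin n → ℝ} (hn : 0 < n) (hy : ∑ i, y i = 0) (i : Fin n)
    {x w : ℝ} (hx : 0 ≤ x) (hxw : y i < 0 → x = w) :
    ∑ j, (min (bump y i x j) 0) ^ 2 - ∑ j, (min (y j) 0) ^ 2 ≤
      2 * x * excess y + x ^ 2 / n - if y i < 0 then deficitDrop w (-y i) else 0 := by
  have h0 : (n : ℝ) ≠ 0 := by positivity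
  have hc : 0 ≤ x / n := by positivity
  rw [sum_bump (fun z => (min z 0) ^ 2)]
  have h1 : ∑ j, (min (y j - x / n) 0) ^ 2 ≤
      ∑ j, (min (y j) 0) ^ 2 + (2 * x * excess y + x ^ 2 / n) := by
    have h2 : ∑ j, max (-y j) 0 = n * excess y := by
      rw [← sum_under_eq hn hy, sum_filter]
      refine sum_congr rfl fun j _ => ?_
      split_ifs with h
      · exact max_eq_left (by linarith)
      · exact max_eq_right (by linarith)
    calc ∑ j, (min (y j - x / n) 0) ^ 2
        ≤ ∑ j, ((min (y j) 0) ^ 2 + 2 * (x / n) * max (-y j) 0 + (x / n) ^ 2) :=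
          sum_le_sum fun j _ => min_sq_sub_le hc
      _ = _ := by
          rw [sum_add_distrib, sum_add_distrib, ← mul_sum, h2]
          simp only [sum_const, card_univ, Fintype.card_fin, nsmul_eq_mul]
          field_simp
          ring
  have h3 : (min (y i - x / n + x) 0) ^ 2 - (min (y i - x / n) 0) ^ 2 ≤
      - if y i < 0 then deficitDrop w (-y i) else 0 := by
    split_ifs with h
    · have hw := hxw h
      subst hw
      -- The mean moves first, so the deficit has grown by `x / n` when the balls arrive; the drop
      -- is then at least the one computed from the old deficit.
      have := deficitDrop_le_of_le (w := x) (a := -y i) (b := -y i + x / n) hx (by linarith)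
        (by linarith)
      refine le_trans (le_of_eq ?_) (neg_le_neg this)
      unfold deficitDrop
      rw [min_eq_left (show y i - x / n ≤ 0 by linarith)]
      have : min (y i - x / n + x) 0 = -max (-y i + x / n - x) 0 := by
        rw [← min_neg_neg]; congr 1 <;> ring
      rw [this]; ring
    · have := min_sq_antitone (show y i - x / n ≤ y i - x / n + x by linarith)
      linarith
  linarith

theorem le_sum_min_sq_bump {n : ℕ} {y : Fin n → ℝ} (i : Fin n) {x w M : ℝ}
    (hx : 0 ≤ x) (hxw : x ≤ w) (hxn : x / n ≤ 1) (hM : |y i| ≤ M) :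
    -(2 * w * (M + 1)) ≤ ∑ j, (min (bump y i x j) 0) ^ 2 - ∑ j, (min (y j) 0) ^ 2 := by
  have hc : 0 ≤ x / n := by positivity
  rw [sum_bump (fun z => (min z 0) ^ 2)]
  have h1 : ∑ j, (min (y j) 0) ^ 2 ≤ ∑ j, (min (y j - x / n) 0) ^ 2 :=
    sum_le_sum fun j _ => min_sq_antitone (by linarith)
  have h2 := (abs_le.1 hM).1
  have h3 : -(2 * x * (M + 1)) ≤ (min (y i - x / n + x) 0) ^ 2 - (min (y i - x / n) 0) ^ 2 := by
    have hM0 : 0 ≤ M := (abs_nonneg _).trans hM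
    rcases min_cases (y i - x / n + x) 0 with ⟨h, h'⟩ | ⟨h, h'⟩ <;>
    rcases min_cases (y i - x / n) 0 with ⟨g, g'⟩ | ⟨g, g'⟩ <;> rw [h, g] <;> nlinarith
  have h4 : 2 * x * (M + 1) ≤ 2 * w * (M + 1) := by
    have hM0 : 0 ≤ M := (abs_nonneg _).trans hM
    nlinarith
  linarith

/-! #### The clamped loads -/

/-- The load `z` on the scale `1 / 8`, truncated to `[-1, 1]`. -/
def clampLoad (z : ℝ) : ℝ := max (-1) (min 1 (8 * z))

theorem neg_one_le_clampLoad (z : ℝ) : -1 ≤ clampLoad z := le_max_left _ _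

theorem clampLoad_le_one (z : ℝ) : clampLoad z ≤ 1 := max_le (by norm_num) (min_le_left _ _)

theorem clampLoad_mono {a b : ℝ} (h : a ≤ b) : clampLoad a ≤ clampLoad b :=
  max_le_max_left _ (min_le_min_left _ (by linarith))

theorem clampLoad_sub_ge {z c : ℝ} (hc : 0 ≤ c) : clampLoad z - 8 * c ≤ clampLoad (z - c) := by
  unfold clampLoad
  rcases max_cases (-1) (min 1 (8 * z)) with ⟨h, h'⟩ | ⟨h, h'⟩ <;>
  rcases max_cases (-1) (min 1 (8 * (z - c))) with ⟨g, g'⟩ | ⟨g, g'⟩ <;>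
  rcases min_cases 1 (8 * z) with ⟨e, e'⟩ | ⟨e, e'⟩ <;>
  rcases min_cases 1 (8 * (z - c)) with ⟨f, f'⟩ | ⟨f, f'⟩ <;> linarith

theorem clampLoad_sub_le {z c : ℝ} (hz : 0 ≤ z) (hz' : z ≤ 1 / 8) (hc : 0 ≤ c) (hc' : 8 * c ≤ 1) :
    clampLoad (z - c) ≤ clampLoad z - 8 * c := by
  have h1 : clampLoad z = 8 * z := by
    unfold clampLoad; rw [min_eq_right (by linarith), max_eq_right (by linarith)]
  have h2 : clampLoad (z - c) = 8 * (z - c) := by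
    unfold clampLoad; rw [min_eq_right (by linarith), max_eq_right (by linarith)]
  rw [h1, h2]; linarith

/-- The chosen bin gains at most 2, the length of the range. A bin in `[0, 1/8]` stays on the linear
part under the shift because `8 * (x / n) ≤ 1`. -/
theorem sum_clampLoad_bump_le {n : ℕ} {y : Fin n → ℝ} (i : Fin n) {x : ℝ}
    (hx : 0 ≤ x) (hxn : 8 * (x / n) ≤ 1) :
    ∑ j, clampLoad (bump y i x j) - ∑ j, clampLoad (y j) ≤
      2 - 8 * (x / n) * #{j | 0 ≤ y j ∧ y j ≤ 1 / 8} := by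
  have hc : 0 ≤ x / n := by positivity
  rw [sum_bump clampLoad]
  have h1 : ∑ j, clampLoad (y j - x / n) ≤
      ∑ j, (clampLoad (y j) - if 0 ≤ y j ∧ y j ≤ 1 / 8 then 8 * (x / n) else 0) := by
    refine sum_le_sum fun j _ => ?_
    split_ifs with h
    · exact clampLoad_sub_le h.1 h.2 hc hxn
    · simpa using clampLoad_mono (show y j - x / n ≤ y j by linarith)
  rw [sum_sub_distrib, ← sum_filter, sum_const, nsmul_eq_mul] at h1
  have h2 := clampLoad_le_one (y i - x / n + x)
  have h3 := neg_one_le_clampLoad (y i - x / n)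
  linarith

theorem le_sum_clampLoad_bump {n : ℕ} {y : Fin n → ℝ} (hn : 0 < n) (i : Fin n) {x : ℝ}
    (hx : 0 ≤ x) : -(8 * x) ≤ ∑ j, clampLoad (bump y i x j) - ∑ j, clampLoad (y j) := by
  have h0 : (n : ℝ) ≠ 0 := by positivity
  have hc : 0 ≤ x / n := by positivity
  rw [sum_bump clampLoad]
  have h1 : ∑ j, (clampLoad (y j) - 8 * (x / n)) ≤ ∑ j, clampLoad (y j - x / n) :=
    sum_le_sum fun j _ => clampLoad_sub_ge hc
  rw [sum_sub_distrib] at h1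
  simp only [sum_const, card_univ, Fintype.card_fin, nsmul_eq_mul] at h1
  have h2 : n * (8 * (x / n)) = 8 * x := by field_simp
  have h3 := clampLoad_mono (show y i - x / n ≤ y i - x / n + x by linarith)
  linarith

/-- Markov's inequality: at most `8 * n * excess y` bins have load above `1 / 8`. -/
theorem card_near_zero_ge {n : ℕ} {y : Fin n → ℝ} (hn : 0 < n) :
    n * (overFrac y - 8 * excess y) ≤ #{j | 0 ≤ y j ∧ y j ≤ 1 / 8} := by
  have h0 : (n : ℝ) ≠ 0 := by positivity
  have h1 : n * overFrac y = #{j | 0 ≤ y j} := by unfold overFrac; field_simp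
  have h2 : ∑ j with 0 ≤ y j, ((1 : ℝ) - 8 * y j) ≤
      ∑ j with 0 ≤ y j, if y j ≤ 1 / 8 then (1 : ℝ) else 0 := by
    refine sum_le_sum fun j hj => ?_
    have : 0 ≤ y j := by simpa using hj
    split_ifs <;> linarith
  rw [sum_sub_distrib, ← mul_sum, sum_over_eq hn, ← sum_filter, filter_filter] at h2
  simp only [sum_const, nsmul_eq_mul, mul_one] at h2
  linarith

/-! #### The capped exponential potential -/

/-- The exponential of the load `z` capped at `w`. -/
def capExp (a w z : ℝ) : ℝ := Real.exp (a * min z w)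

theorem capExp_pos (a w z : ℝ) : 0 < capExp a w z := Real.exp_pos _

theorem capExp_le {a w z : ℝ} (ha : 0 ≤ a) : capExp a w z ≤ Real.exp (a * w) :=
  Real.exp_le_exp.2 (mul_le_mul_of_nonneg_left (min_le_right _ _) ha)

theorem capExp_mono {a w b c : ℝ} (ha : 0 ≤ a) (h : b ≤ c) : capExp a w b ≤ capExp a w c :=
  Real.exp_le_exp.2 (mul_le_mul_of_nonneg_left (min_le_min_right _ h) ha)

theorem capExp_sub_ge {a w z c : ℝ} (ha : 0 ≤ a) (hc : 0 ≤ c) :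
    capExp a w z * (1 - a * c) ≤ capExp a w (z - c) := by
  have h1 : min z w - c ≤ min (z - c) w :=
    le_min (by linarith [min_le_left z w]) (by linarith [min_le_right z w])
  calc capExp a w z * (1 - a * c) ≤ capExp a w z * Real.exp (-(a * c)) := by
        gcongr
        · exact (capExp_pos _ _ _).le
        · linarith [Real.add_one_le_exp (-(a * c))]
    _ = Real.exp (a * (min z w - c)) := by rw [capExp, ← Real.exp_add]; congr 1; ring
    _ ≤ _ := Real.exp_le_exp.2 (mul_le_mul_of_nonneg_left h1 ha)

/-- The cap equals the weight of an underloaded bin, so such a bin cannot pass it and its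
exponential gains the full factor `exp (a * w)`. The division by 2 absorbs the preceding shift. -/
theorem le_sum_capExp_bump {n : ℕ} {y : Fin n → ℝ} (i : Fin n) {a x w : ℝ} (ha : 0 ≤ a)
    (hx : 0 ≤ x) (hxw : y i < 0 → x = w) (hw : 0 ≤ w) (hn : a * (x / n) ≤ 1 / 2) :
    -(a * (x / n)) * ∑ j, capExp a w (y j) +
      (if y i < 0 then (Real.exp (a * w) - 1) / 2 * capExp a w (y i) else 0) ≤
        ∑ j, capExp a w (bump y i x j) - ∑ j, capExp a w (y j) := by
  have hc : 0 ≤ x / n := by positivity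
  rw [sum_bump (capExp a w)]
  have h1 : ∑ j, capExp a w (y j) * (1 - a * (x / n)) ≤ ∑ j, capExp a w (y j - x / n) :=
    sum_le_sum fun j _ => capExp_sub_ge ha hc
  rw [← sum_mul] at h1
  have h2 : (if y i < 0 then (Real.exp (a * w) - 1) / 2 * capExp a w (y i) else 0) ≤
      capExp a w (y i - x / n + x) - capExp a w (y i - x / n) := by
    split_ifs with h
    · have hxw' := hxw h
      subst hxw'
      have h3 : capExp a x (y i - x / n + x) = Real.exp (a * x) * capExp a x (y i - x / n) := by
        rw [capExp, capExp, ← Real.exp_add, min_eq_left (by linarith), min_eq_left (by linarith)]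
        congr 1; ring
      have h4 : capExp a x (y i) / 2 ≤ capExp a x (y i - x / n) := by
        refine le_trans ?_ (capExp_sub_ge ha hc)
        have := capExp_pos a x (y i)
        nlinarith
      have h5 : 1 ≤ Real.exp (a * x) := Real.one_le_exp (by positivity)
      rw [h3]
      nlinarith
    · have := capExp_mono (w := w) ha (show y i - x / n ≤ y i - x / n + x by linarith)
      linarith
  linarith

theorem sum_capExp_bump_le {n : ℕ} {y : Fin n → ℝ} (i : Fin n) {a x w : ℝ} (ha : 0 ≤ a)
    (hx : 0 ≤ x) :
    ∑ j, capExp a w (bump y i x j) - ∑ j, capExp a w (y j) ≤ Real.exp (a * w) := by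
  have hc : 0 ≤ x / n := by positivity
  rw [sum_bump (capExp a w)]
  have h1 : ∑ j, capExp a w (y j - x / n) ≤ ∑ j, capExp a w (y j) :=
    sum_le_sum fun j _ => capExp_mono ha (by linarith)
  have h2 := capExp_le (w := w) (z := y i - x / n + x) ha
  have h3 := capExp_pos a w (y i - x / n)
  linarith

theorem sum_capExp_le {n : ℕ} {y : Fin n → ℝ} {a w : ℝ} (ha : 0 ≤ a) :
    ∑ j, capExp a w (y j) ≤ n * Real.exp (a * w) := by
  calc ∑ j, capExp a w (y j) ≤ ∑ _j : Fin n, Real.exp (a * w) :=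
        sum_le_sum fun j _ => capExp_le ha
    _ = _ := by simp

/-- If few bins are overloaded and the excess is bounded then many bins are slightly underloaded. -/
theorem le_sum_under_capExp {n : ℕ} {y : Fin n → ℝ} (hn : 0 < n) (hy : ∑ i, y i = 0) {a w C : ℝ}
    (ha : 0 ≤ a) (hw : 0 ≤ w) (hC : 0 < C) (hδ : overFrac y ≤ 1 / 4) (hs : excess y ≤ C) :
    n * (Real.exp (-(4 * a * C)) / 2) ≤ ∑ i with y i < 0, capExp a w (y i) := by
  have h0 : (0 : ℝ) < n := by positivity
  -- The linear factor lies below the indicator of a deficit of at most `4 * C`. Its sum is at least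
  -- `n / 2`, since at least `3 * n / 4` bins are underloaded and their deficits add up to at most
  -- `C * n`.
  have h1 : ∑ i with y i < 0, (1 - -y i / (4 * C)) * Real.exp (-(4 * a * C)) ≤
      ∑ i with y i < 0, capExp a w (y i) := by
    refine sum_le_sum fun i hi => ?_
    have hi : y i < 0 := by simpa using hi
    by_cases h : -y i ≤ 4 * C
    · have h2 : Real.exp (-(4 * a * C)) ≤ capExp a w (y i) := by
        rw [capExp, min_eq_left (by linarith)]
        exact Real.exp_le_exp.2 (by nlinarith)
      have h3 : 0 ≤ -y i / (4 * C) := div_nonneg (by linarith) (by linarith)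
      have h4 := Real.exp_pos (-(4 * a * C))
      nlinarith
    · have h3 : 1 ≤ -y i / (4 * C) := by rw [le_div_iff₀ (by linarith)]; linarith
      have h4 := Real.exp_pos (-(4 * a * C))
      have h5 := capExp_pos a w (y i)
      nlinarith
  refine le_trans ?_ h1
  rw [← sum_mul, sum_sub_distrib, ← sum_div, sum_under_eq hn hy]
  simp only [sum_const, nsmul_eq_mul, mul_one]
  rw [card_under hn]
  have h2 : n * excess y / (4 * C) ≤ n / 4 := by
    rw [div_le_iff₀ (by linarith)]; nlinarith
  have h4 := Real.exp_pos (-(4 * a * C))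
  have h5 : (n : ℝ) / 2 ≤ n * (1 - overFrac y) - n * excess y / (4 * C) := by nlinarith
  nlinarith [mul_le_mul_of_nonneg_right h5 h4.le]

end

/-! ### Expected change of the potentials -/

noncomputable section

namespace BiasedStep

variable {n : ℕ} {y p x : Fin n → ℝ} {w k₂ k : ℝ}

theorem sum_p_mul_const (h : BiasedStep y p x w k₂ k) (c : ℝ) : ∑ i, p i * c = c := by
  rw [← sum_mul, h.sum_p, one_mul]

theorem one_le_w (h : BiasedStep y p x w k₂ k) : 1 ≤ w :=
  (h.one_le_x ⟨0, h.n_pos⟩).trans (h.x_le _)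

theorem x_nonneg (h : BiasedStep y p x w k₂ k) (i : Fin n) : 0 ≤ x i :=
  zero_le_one.trans (h.one_le_x i)

theorem mean_le (h : BiasedStep y p x w k₂ k) : ∑ i, p i * x i ≤ w := by
  rw [← h.sum_p_mul_const w]
  exact sum_le_sum fun i _ => mul_le_mul_of_nonneg_left (h.x_le i) (h.p_nonneg i)

theorem sum_mono (h : BiasedStep y p x w k₂ k) {f g : Fin n → ℝ} (hfg : ∀ i, f i ≤ g i) :
    ∑ i, p i * f i ≤ ∑ i, p i * g i :=
  sum_le_sum fun i _ => mul_le_mul_of_nonneg_left (hfg i) (h.p_nonneg i)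

theorem x_sq_le (h : BiasedStep y p x w k₂ k) (i : Fin n) : x i ^ 2 ≤ w ^ 2 :=
  pow_le_pow_left₀ (h.x_nonneg i) (h.x_le i) 2

theorem drift_sq (h : BiasedStep y p x w k₂ k) :
    ∑ i, p i * (∑ j, bump y i (x i) j ^ 2 - ∑ j, y j ^ 2) ≤ -2 * k * excess y + w ^ 2 := by
  calc ∑ i, p i * (∑ j, bump y i (x i) j ^ 2 - ∑ j, y j ^ 2)
      ≤ ∑ i, p i * (2 * (x i * y i) + w ^ 2) := h.sum_mono fun i => by
        rw [sum_sq_bump h.n_pos h.sum_y]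
        have := h.x_sq_le i
        have : 0 ≤ x i ^ 2 / n := by positivity
        linarith
    _ = 2 * ∑ i, p i * (x i * y i) + w ^ 2 := by
        simp_rw [mul_add, sum_add_distrib, h.sum_p_mul_const, mul_sum]
        congr 1
        exact sum_congr rfl fun i _ => by ring
    _ ≤ _ := by linarith [h.sum_mul_le]

theorem drift_min_sq (h : BiasedStep y p x w k₂ k) :
    ∑ i, p i * (∑ j, (min (bump y i (x i) j) 0) ^ 2 - ∑ j, (min (y j) 0) ^ 2) ≤
      2 * (∑ i, p i * x i) * excess y - ∑ i with y i < 0, p i * deficitDrop w (-y i)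
        + w ^ 2 / n := by
  calc ∑ i, p i * (∑ j, (min (bump y i (x i) j) 0) ^ 2 - ∑ j, (min (y j) 0) ^ 2)
      ≤ ∑ i, p i * (2 * x i * excess y + w ^ 2 / n -
          if y i < 0 then deficitDrop w (-y i) else 0) := h.sum_mono fun i => by
        refine (sum_min_sq_bump_le h.n_pos h.sum_y i (h.x_nonneg i) (h.x_eq i)).trans ?_
        have := div_le_div_of_nonneg_right (h.x_sq_le i) (Nat.cast_nonneg (α := ℝ) n)
        linarith
    _ = _ := by
        simp_rw [mul_sub, mul_add, sum_sub_distrib, sum_add_distrib, h.sum_p_mul_const]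
        have h1 : ∑ i, p i * (2 * x i * excess y) = 2 * (∑ i, p i * x i) * excess y := by
          rw [mul_sum, sum_mul]; exact sum_congr rfl fun i _ => by ring
        rw [h1, sum_filter]
        simp_rw [mul_ite, mul_zero]
        ring

/-- No strict bias is needed: the rising mean costs at most `2 * w * excess y`, and by `le_under`
and `le_deficitDrop` the allocations win back the same amount up to `w ^ 2`. -/
theorem drift_min_sq_le (h : BiasedStep y p x w k₂ k) :
    ∑ i, p i * (∑ j, (min (bump y i (x i) j) 0) ^ 2 - ∑ j, (min (y j) 0) ^ 2) ≤ 2 * w ^ 2 := by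
  refine h.drift_min_sq.trans ?_
  have h0 : (1 : ℝ) ≤ n := by exact_mod_cast h.n_pos
  have h1 := h.le_under
  have h2 : 2 * w * excess y - w ^ 2 ≤ (∑ i with y i < 0, deficitDrop w (-y i)) / n := by
    rw [le_div_iff₀ (by linarith)]
    have h3 : ∑ i with y i < 0, (2 * w * -y i - w ^ 2) ≤
        ∑ i with y i < 0, deficitDrop w (-y i) := sum_le_sum fun i _ => le_deficitDrop _ _
    rw [sum_sub_distrib, ← mul_sum, sum_under_eq h.n_pos h.sum_y, sum_const, nsmul_eq_mul,
      card_under h.n_pos] at h3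
    have h4 : n * (1 - overFrac y) * w ^ 2 ≤ n * w ^ 2 := by
      have := overFrac_nonneg (y := y)
      have : 0 ≤ n * w ^ 2 := by positivity
      nlinarith
    linarith
  have h3 : 2 * (∑ i, p i * x i) * excess y ≤ 2 * w * excess y := by
    have := h.mean_le
    have := excess_nonneg (y := y)
    nlinarith
  have h4 : w ^ 2 / n ≤ w ^ 2 := div_le_self (by positivity) h0
  linarith

theorem drift_min_sq_high (h : BiasedStep y p x w k₂ k) (hδ : 3 / 4 ≤ overFrac y) :
    ∑ i, p i * (∑ j, (min (bump y i (x i) j) 0) ^ 2 - ∑ j, (min (y j) 0) ^ 2) ≤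
      -k * excess y + 2 * w ^ 2 * (1 - overFrac y) + w ^ 2 / n := by
  linarith [h.drift_min_sq, h.high hδ]

theorem drift_clampLoad (h : BiasedStep y p x w k₂ k) (hn : 8 * (w / n) ≤ 1) :
    ∑ i, p i * (∑ j, clampLoad (bump y i (x i) j) - ∑ j, clampLoad (y j)) ≤
      2 - 8 * max (overFrac y - 8 * excess y) 0 := by
  have h0 : (0 : ℝ) < n := by exact_mod_cast h.n_pos
  have hxn : ∀ i, x i / n ≤ w / n := fun i => by gcongr; exact h.x_le i
  have h1 : max (overFrac y - 8 * excess y) 0 ≤ (#{j | 0 ≤ y j ∧ y j ≤ 1 / 8} : ℝ) / n := by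
    refine max_le ?_ (by positivity)
    rw [le_div_iff₀ h0, mul_comm]
    exact card_near_zero_ge h.n_pos
  rw [← h.sum_p_mul_const (2 - 8 * max (overFrac y - 8 * excess y) 0)]
  refine h.sum_mono fun i => ?_
  refine (sum_clampLoad_bump_le i (h.x_nonneg i) (by linarith [hxn i])).trans ?_
  have h2 : x i / n * (#{j | 0 ≤ y j ∧ y j ≤ 1 / 8} : ℝ) =
      x i * ((#{j | 0 ≤ y j ∧ y j ≤ 1 / 8} : ℝ) / n) := by ring
  rw [mul_assoc, h2]
  have h3 : 0 ≤ max (overFrac y - 8 * excess y) 0 := le_max_right _ _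
  have h4 := h.one_le_x i
  nlinarith

/-- For underloaded bins, `hk₂` makes the expected gain at least twice the loss caused by the rising
mean, although the probability may be as small as `k₂ / n`. The loss of the overloaded bins is
bounded thanks to the cap and gives the negative term. -/
theorem drift_capExp (h : BiasedStep y p x w k₂ k) {a : ℝ} (ha : 1 ≤ a * w)
    (hk₂ : 4 * (a * w) ≤ k₂ * (Real.exp (a * w) - 1)) (hn : a * (w / n) ≤ 1 / 2) :
    (∑ i with y i < 0, capExp a w (y i)) / n - a * w * Real.exp (a * w) * overFrac y ≤
      ∑ i, p i * (∑ j, capExp a w (bump y i (x i) j) - ∑ j, capExp a w (y j)) := by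
  have h0 : (0 : ℝ) < n := by exact_mod_cast h.n_pos
  have hw := h.one_le_w
  have ha0 : 0 ≤ a := by
    by_contra hc
    nlinarith
  have hxn : ∀ i, a * (x i / n) ≤ a * (w / n) := fun i => by gcongr; exact h.x_le i
  set S := ∑ i with y i < 0, capExp a w (y i) with hS
  have hS0 : 0 ≤ S := sum_nonneg fun i _ => (capExp_pos _ _ _).le
  have hT : ∑ j, capExp a w (y j) ≤ n * overFrac y * Real.exp (a * w) + S := by
    rw [← sum_over_add_sum_under (y := y)]
    gcongr
    calc ∑ i with 0 ≤ y i, capExp a w (y i) ≤ ∑ i with 0 ≤ y i, Real.exp (a * w) :=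
          sum_le_sum fun i _ => capExp_le ha0
      _ = _ := by
        rw [sum_const, nsmul_eq_mul]
        unfold overFrac
        field_simp
  have hE : 0 ≤ Real.exp (a * w) - 1 := by
    have := Real.one_le_exp (show 0 ≤ a * w by linarith)
    linarith
  have h1 : -(a * (w / n)) * (∑ j, capExp a w (y j)) +
      ∑ i with y i < 0, p i * ((Real.exp (a * w) - 1) / 2 * capExp a w (y i)) ≤
      ∑ i, p i * (∑ j, capExp a w (bump y i (x i) j) - ∑ j, capExp a w (y j)) := by
    rw [← h.sum_p_mul_const (-(a * (w / n)) * (∑ j, capExp a w (y j))), sum_filter,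
      ← sum_add_distrib]
    refine sum_le_sum fun i _ => ?_
    have h2 := le_sum_capExp_bump i ha0 (h.x_nonneg i) (h.x_eq i) (by linarith)
      ((hxn i).trans hn)
    have h3 : 0 ≤ ∑ j, capExp a w (y j) := sum_nonneg fun i _ => (capExp_pos _ _ _).le
    have h4 := mul_le_mul_of_nonneg_right (hxn i) h3
    refine le_trans ?_ (mul_le_mul_of_nonneg_left h2 (h.p_nonneg i))
    have h5 := mul_le_mul_of_nonneg_left h4 (h.p_nonneg i)
    split_ifs <;> linarith
  have h2 : 2 * (a * w) / n * S ≤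
      ∑ i with y i < 0, p i * ((Real.exp (a * w) - 1) / 2 * capExp a w (y i)) := by
    rw [hS, mul_sum]
    refine sum_le_sum fun i hi => ?_
    have hi : y i < 0 := by simpa using hi
    have h3 := h.le_p i hi
    have h4 : 2 * (a * w) / n ≤ k₂ / n * ((Real.exp (a * w) - 1) / 2) := by
      rw [div_mul_eq_mul_div]
      exact div_le_div_of_nonneg_right (by linarith) h0.le
    have h5 : 2 * (a * w) / n ≤ p i * ((Real.exp (a * w) - 1) / 2) :=
      h4.trans (mul_le_mul_of_nonneg_right h3 (by linarith))
    rw [← mul_assoc (p i)]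
    exact mul_le_mul_of_nonneg_right h5 (capExp_pos _ _ _).le
  refine le_trans ?_ h1
  refine le_trans ?_ (add_le_add_right h2 _)
  have h3 : a * (w / n) * (∑ j, capExp a w (y j)) ≤
      a * (w / n) * (n * overFrac y * Real.exp (a * w) + S) :=
    mul_le_mul_of_nonneg_left hT (by positivity)
  have h4 : a * (w / n) * (n * overFrac y * Real.exp (a * w) + S) =
      a * w * Real.exp (a * w) * overFrac y + a * w / n * S := by
    field_simp
  have h5 : S / n ≤ a * w / n * S := by
    have : S / n * 1 ≤ S / n * (a * w) := mul_le_mul_of_nonneg_left ha (by positivity)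
    calc S / n ≤ S / n * (a * w) := by linarith
      _ = _ := by ring
  have h6 : 2 * (a * w) / n * S = 2 * (a * w / n * S) := by ring
  linarith

end BiasedStep

/-! ### The combined potential -/

/-- The part of the potential that controls rounds with few overloaded bins. As soon as there are
`2 ε n + 1` overloaded bins, it has its maximal value `K n`. -/
def lowPotential {n : ℕ} (a w ε : ℝ) (y : Fin n → ℝ) : ℝ :=
  max (Real.exp (a * w) * n - ∑ j, capExp a w (y j))
    (min (Real.exp (a * w) * n)
      (Real.exp (a * w) / ε * ((#{i | 0 ≤ y i} : ℝ) - 1 - ε * n)))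

theorem card_over_bump_le {n : ℕ} (y : Fin n → ℝ) (i : Fin n) {x : ℝ} (hx : 0 ≤ x) :
    (#{j | 0 ≤ bump y i x j} : ℝ) ≤ #{j | 0 ≤ y j} + 1 := by
  have hsub : ({j | 0 ≤ bump y i x j} : Finset (Fin n)) ⊆
      insert i ({j | 0 ≤ y j} : Finset (Fin n)) := by
    intro j hj
    have hj' : 0 ≤ bump y i x j := by simpa using hj
    have hx' : 0 ≤ x / n := by positivity
    rw [mem_insert, mem_filter]
    by_cases h : j = i
    · exact Or.inl h
    · rw [bump, if_neg h] at hj'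
      exact Or.inr ⟨mem_univ _, by linarith⟩
  exact_mod_cast (card_le_card hsub).trans (card_insert_le _ _)

theorem lowPotential_nonneg {n : ℕ} {a w ε : ℝ} (ha : 0 ≤ a) (y : Fin n → ℝ) :
    0 ≤ lowPotential a w ε y :=
  le_max_of_le_left (by linarith [sum_capExp_le (y := y) (w := w) ha])

theorem lowPotential_le {n : ℕ} {a w ε : ℝ} (y : Fin n → ℝ) :
    lowPotential a w ε y ≤ Real.exp (a * w) * n := by
  refine max_le ?_ (min_le_left _ _)
  have : 0 ≤ ∑ j, capExp a w (y j) := sum_nonneg fun i _ => (capExp_pos _ _ _).le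
  linarith

/-- A bound for the increase of `lowPotential` when bin `i` receives `x` balls. -/
def lowIncrease {n : ℕ} (a w ε : ℝ) (y : Fin n → ℝ) (i : Fin n) (x : ℝ) : ℝ :=
  if overFrac y < ε then ∑ j, capExp a w (y j) - ∑ j, capExp a w (bump y i x j)
  else if 1 - ε < overFrac y then 0
  else a * w * Real.exp (a * w) + Real.exp (a * w) / ε

theorem sum_capExp_sub_bump_le {n : ℕ} {y : Fin n → ℝ} (hn : 0 < n) (i : Fin n) {a x w : ℝ}
    (ha : 0 ≤ a) (hx : 0 ≤ x) (hxw : x ≤ w) :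
    ∑ j, capExp a w (y j) - ∑ j, capExp a w (bump y i x j) ≤ a * w * Real.exp (a * w) := by
  have h0 : (0 : ℝ) < n := by positivity
  have hc : 0 ≤ x / n := by positivity
  rw [sum_bump (capExp a w)]
  have h1 : ∑ j, capExp a w (y j) * (1 - a * (x / n)) ≤ ∑ j, capExp a w (y j - x / n) :=
    sum_le_sum fun j _ => capExp_sub_ge ha hc
  rw [← sum_mul] at h1
  have h2 := capExp_mono (w := w) ha (show y i - x / n ≤ y i - x / n + x by linarith)
  have h3 : (∑ j, capExp a w (y j)) * (a * (x / n)) ≤ n * Real.exp (a * w) * (a * (w / n)) := by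
    gcongr
    exact sum_capExp_le ha
  have h4 : n * Real.exp (a * w) * (a * (w / n)) = a * w * Real.exp (a * w) := by field_simp
  linarith

/-- One allocation creates at most one overloaded bin, which the `- 1` in the ramp anticipates.
Below `ε` the ramp is therefore still nonpositive afterwards, so only the exponentials matter; above
`1 - ε` the potential is saturated and cannot rise. The climb in between is paid for by balanced
rounds. -/
theorem lowPotential_bump_le {n : ℕ} (hn : 2 ≤ n) {a w ε : ℝ} (ha : 0 ≤ a) (hε : 0 < ε)
    (hε' : ε ≤ 1 / 8) (y : Fin n → ℝ) (i : Fin n) {x : ℝ} (hx : 0 ≤ x) (hxw : x ≤ w) :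
    lowPotential a w ε (bump y i x) ≤ lowPotential a w ε y + lowIncrease a w ε y i x := by
  have h0 : (0 : ℝ) < n := by positivity
  have h0' : (2 : ℝ) ≤ n := by exact_mod_cast hn
  have hK := Real.exp_pos (a * w)
  have hcard := card_over_bump_le y i hx
  have hfrac : (#{j | 0 ≤ y j} : ℝ) = n * overFrac y := by unfold overFrac; field_simp
  have hsink := sum_capExp_sub_bump_le (y := y) (by omega) i ha hx hxw
  unfold lowIncrease
  split_ifs with h1 h2
  · have h3 : Real.exp (a * w) * n - ∑ j, capExp a w (y j) ≤ lowPotential a w ε y :=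
      le_max_left _ _
    have h4 : Real.exp (a * w) / ε * ((#{j | 0 ≤ bump y i x j} : ℝ) - 1 - ε * n) ≤ 0 := by
      apply mul_nonpos_of_nonneg_of_nonpos (by positivity)
      nlinarith
    have h5 := sum_capExp_le (y := bump y i x) (w := w) ha
    refine max_le (by linarith) ((min_le_right _ _).trans ?_)
    linarith
  · have h3 : Real.exp (a * w) * n ≤ lowPotential a w ε y := by
      refine le_max_of_le_right (le_min le_rfl ?_)
      rw [div_mul_eq_mul_div, le_div_iff₀ hε, mul_assoc]
      apply mul_le_mul_of_nonneg_left _ hK.le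
      rw [hfrac]
      nlinarith
    linarith [lowPotential_le (a := a) (w := w) (ε := ε) (bump y i x)]
  · have hKε : 0 < Real.exp (a * w) / ε := by positivity
    have hAK : 0 ≤ a * w * Real.exp (a * w) := by
      have : 0 ≤ w := hx.trans hxw
      positivity
    refine max_le ?_ ?_
    · have h3 : Real.exp (a * w) * n - ∑ j, capExp a w (y j) ≤ lowPotential a w ε y :=
        le_max_left _ _
      linarith
    · have h3 : min (Real.exp (a * w) * n)
          (Real.exp (a * w) / ε * ((#{i | 0 ≤ y i} : ℝ) - 1 - ε * n)) ≤ lowPotential a w ε y :=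
        le_max_right _ _
      refine le_trans ?_ (add_le_add_left h3 _)
      rw [← min_add_add_right]
      refine min_le_min (by linarith) ?_
      have := mul_le_mul_of_nonneg_left hcard hKε.le
      linarith

/-! ### Bounds for a single step -/

namespace BiasedStep

variable {n : ℕ} {y p x : Fin n → ℝ} {w k₂ k M : ℝ}

theorem le_sq_mul (h : BiasedStep y p x w k₂ k) (hM : 1 ≤ M) :
    w * M ≤ w ^ 2 * M ∧ w ^ 2 ≤ w ^ 2 * M ∧ w ≤ w * M := by
  have hw := h.one_le_w
  have hww : w ≤ w ^ 2 := by nlinarith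
  exact ⟨mul_le_mul_of_nonneg_right hww (by linarith),
    le_mul_of_one_le_right (by positivity) hM, le_mul_of_one_le_right (by linarith) hM⟩

theorem abs_sum_sq_bump_sub_le (h : BiasedStep y p x w k₂ k) (hM : 1 ≤ M) (hy : ∀ i, |y i| ≤ M)
    (i : Fin n) : |∑ j, bump y i (x i) j ^ 2 - ∑ j, y j ^ 2| ≤ 3 * w ^ 2 * M := by
  have hn : (1 : ℝ) ≤ n := by exact_mod_cast h.n_pos
  obtain ⟨e1, e2, e3⟩ := h.le_sq_mul hM
  rw [sum_sq_bump h.n_pos h.sum_y]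
  have h2 : 0 ≤ x i ^ 2 / n := by positivity
  have h3 : x i ^ 2 / n ≤ x i ^ 2 := div_le_self (by positivity) hn
  have h4 : |x i * y i| ≤ w * M := by
    rw [abs_mul, abs_of_nonneg (h.x_nonneg i)]
    exact mul_le_mul (h.x_le i) (hy i) (abs_nonneg _) (by linarith [h.one_le_w])
  have h5 := abs_le.1 h4
  have h6 := h.x_sq_le i
  rw [abs_le]
  constructor <;> linarith

theorem abs_sum_min_sq_bump_sub_le (h : BiasedStep y p x w k₂ k) (hM : 1 ≤ M)
    (hy : ∀ i, |y i| ≤ M) (i : Fin n) (hn : w / n ≤ 1) :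
    |∑ j, (min (bump y i (x i) j) 0) ^ 2 - ∑ j, (min (y j) 0) ^ 2| ≤ 4 * w ^ 2 * M := by
  have hn1 : (1 : ℝ) ≤ n := by exact_mod_cast h.n_pos
  have hw := h.one_le_w
  obtain ⟨e1, e2, e3⟩ := h.le_sq_mul hM
  have hxn : x i / n ≤ w / n := by gcongr; exact h.x_le i
  rw [abs_le]
  constructor
  · have := le_sum_min_sq_bump i (h.x_nonneg i) (h.x_le i) (hxn.trans hn) (hy i)
    linarith
  · have h3 := sum_min_sq_bump_le h.n_pos h.sum_y i (h.x_nonneg i) (h.x_eq i)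
    have h4 : 0 ≤ if y i < 0 then deficitDrop w (-y i) else 0 := by
      split_ifs with hc
      · exact deficitDrop_nonneg (by linarith) (by linarith)
      · exact le_rfl
    have h5 : x i ^ 2 / n ≤ x i ^ 2 := div_le_self (by positivity) hn1
    have h6 : x i * excess y ≤ w * M :=
      mul_le_mul (h.x_le i) (excess_le h.n_pos hy) excess_nonneg (by linarith)
    have h7 := h.x_sq_le i
    linarith

theorem abs_sum_clampLoad_bump_sub_le (h : BiasedStep y p x w k₂ k) (hM : 1 ≤ M) (i : Fin n)
    (hn : 8 * (w / n) ≤ 1) :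
    |∑ j, clampLoad (bump y i (x i) j) - ∑ j, clampLoad (y j)| ≤ 10 * w * M := by
  have hw := h.one_le_w
  obtain ⟨e1, e2, e3⟩ := h.le_sq_mul hM
  have hxw := h.x_le i
  have hxn : x i / n ≤ w / n := by gcongr
  rw [abs_le]
  constructor
  · have := le_sum_clampLoad_bump (y := y) h.n_pos i (h.x_nonneg i)
    linarith
  · have := sum_clampLoad_bump_le (y := y) i (h.x_nonneg i) (by linarith)
    have h3 := h.x_nonneg i
    have h4 : 0 ≤ 8 * (x i / n) * (#{j | 0 ≤ y j ∧ y j ≤ 1 / 8} : ℝ) := by positivity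
    linarith

theorem abs_lowIncrease_le (h : BiasedStep y p x w k₂ k) {a ε : ℝ} (ha : 0 ≤ a) (hε : 0 < ε)
    (hM : 1 ≤ M) (i : Fin n) :
    |lowIncrease a w ε y i (x i)| ≤
      (a * w * Real.exp (a * w) + Real.exp (a * w) / ε + Real.exp (a * w)) * M := by
  have h6 := sum_capExp_sub_bump_le (y := y) h.n_pos i ha (h.x_nonneg i) (h.x_le i)
  have h7 := sum_capExp_bump_le (y := y) (w := w) i ha (h.x_nonneg i)
  have hw := h.one_le_w
  have h8 : 0 < Real.exp (a * w) := Real.exp_pos _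
  have h9 : 0 ≤ a * w * Real.exp (a * w) := by positivity
  have h10 : 0 < Real.exp (a * w) / ε := by positivity
  refine le_trans ?_ (le_mul_of_one_le_right (by positivity) hM)
  rw [abs_le]
  unfold lowIncrease
  split_ifs <;> constructor <;> linarith

end BiasedStep

theorem sum_mul_combination {ι : Type*} [Fintype ι] (p f g e d : ι → ℝ) (α β ζ : ℝ) :
    ∑ i, p i * (α * f i + β * g i + e i + ζ * d i) =
      α * ∑ i, p i * f i + β * ∑ i, p i * g i + ∑ i, p i * e i + ζ * ∑ i, p i * d i := by
  simp only [mul_sum, ← sum_add_distrib]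
  exact sum_congr rfl fun i _ => by ring

/-- A potential of linear size which decreases in expectation in every round whose mean quantile
is not bounded away from `0` and `1`. -/
theorem exists_potential {k₂ k w : ℝ} (hk₂ : k₂ ∈ Set.Ioc (0 : ℝ) 1) (hk : 0 < k) (hw : 1 ≤ w) :
    ∃ ε ∈ Set.Ioo (0 : ℝ) (1 / 2), ∃ B ≥ 1, ∃ C₀ ≥ 0, ∃ D ≥ 0, ∃ n₀ : ℕ, ∀ n ≥ n₀,
      ∃ F : (Fin n → ℝ) → ℝ, (∀ y, -(n : ℝ) ≤ F y) ∧ F (fun _ => 0) ≤ C₀ * n ∧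
        ∀ (y p x : Fin n → ℝ) (M : ℝ), 1 ≤ M → BiasedStep y p x w k₂ k → (∀ i, |y i| ≤ M) →
          ∃ ξ : Fin n → ℝ, (∀ i, F (bump y i (x i)) ≤ F y + ξ i) ∧ (∀ i, |ξ i| ≤ B * M) ∧
            ∑ i, p i * ξ i ≤ if overFrac y ∈ Set.Icc ε (1 - ε) then D else -(1 / 2) := by
  obtain ⟨hk₂0, hk₂1⟩ := hk₂
  have hw0 : 0 < w := by linarith
  -- With `k₂ * (a * w) = 8`, the terms of `exp` up to second order already give `hexp`.
  obtain ⟨a, ha0, haw⟩ : ∃ a : ℝ, 0 < a ∧ a * w = 8 / k₂ :=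
    ⟨8 / k₂ / w, by positivity, by field_simp⟩
  have hA8 : 8 ≤ a * w := by rw [haw, le_div_iff₀ hk₂0]; linarith
  have hexp : 4 * (a * w) ≤ k₂ * (Real.exp (a * w) - 1) := by
    have h1 := Real.quadratic_le_exp_of_nonneg (show 0 ≤ a * w by linarith)
    have h2 : k₂ * (a * w) = 8 := by rw [haw]; field_simp
    have h3 : k₂ * (1 + a * w + (a * w) ^ 2 / 2) ≤ k₂ * Real.exp (a * w) :=
      mul_le_mul_of_nonneg_left h1 hk₂0.le
    nlinarith
  set K := Real.exp (a * w) with hK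
  have hK0 : 0 < K := Real.exp_pos _
  set α := 1 / (2 * w ^ 2) with hα
  have hα0 : 0 < α := by positivity
  have hαw : α * w ^ 2 = 1 / 2 := by rw [hα]; field_simp
  -- In a high round with excess above `1 / 32` the deficits contribute below -4. This covers at
  -- most 2 from the clamped loads and three errors of at most `1 / 2`, and leaves `-1 / 2`.
  set β := 128 / k with hβ
  have hβ0 : 0 < β := by positivity
  have hβk : β * k = 128 := by rw [hβ]; field_simp
  -- In a low round with excess above `C` the squares pay for all other terms, including a rise of
  -- the last term by up to `ζ * c₂`.
  obtain ⟨C, hC0, hC⟩ : ∃ C : ℝ, 0 < C ∧ 2 * α * k * C = 6 + 4 * (β * w ^ 2) :=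
    ⟨(6 + 4 * (β * w ^ 2)) / (2 * α * k), by positivity, by field_simp⟩
  set c₂ := Real.exp (-(4 * a * C)) / 4 with hc₂
  have hc₂0 : 0 < c₂ := by positivity
  -- In a low round with excess at most `C` the other terms drift by at most `5 / 2 + 2 * (β * w ^
  -- 2)`; a fall by `ζ * c₂` exceeds this by `1 / 2`.
  obtain ⟨ζ, hζ0, hζ⟩ : ∃ ζ : ℝ, 0 < ζ ∧ ζ * c₂ = 3 + 2 * (β * w ^ 2) :=
    ⟨(3 + 2 * (β * w ^ 2)) / c₂, by positivity, by field_simp⟩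
  -- In low rounds the overloaded bins may spoil at most half of the growth `2 * c₂` of the
  -- exponentials; in high rounds the underloaded bins may cost at most `1 / 2`.
  obtain ⟨ε, hε0, hε8, hεc, hεβ⟩ : ∃ ε : ℝ, 0 < ε ∧ ε ≤ 1 / 8 ∧ a * w * K * ε ≤ c₂ ∧
      4 * (β * w ^ 2) * ε ≤ 1 := by
    have h1 : 0 < a * w * K := by positivity
    refine ⟨min (1 / 8) (min (c₂ / (a * w * K)) (1 / (4 * (β * w ^ 2)))), by positivity,
      min_le_left _ _, ?_, ?_⟩
    · have := (min_le_right (1 / 8) (min (c₂ / (a * w * K)) (1 / (4 * (β * w ^ 2))))).trans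
        (min_le_left _ _)
      rwa [le_div_iff₀ h1, mul_comm] at this
    · have := (min_le_right (1 / 8) (min (c₂ / (a * w * K)) (1 / (4 * (β * w ^ 2))))).trans
        (min_le_right _ _)
      rwa [le_div_iff₀ (by positivity), mul_comm] at this
  set D₀ := a * w * K + K / ε with hD₀
  have hD₀0 : 0 < D₀ := by positivity
  have hD₀1 : a * w * K ≤ D₀ := le_add_of_nonneg_right (by positivity)
  refine ⟨ε, ⟨hε0, by linarith⟩, α * (3 * w ^ 2) + β * (4 * w ^ 2) + 10 * w + ζ * (D₀ + K), ?_,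
    ζ * K, by positivity, 1 / 2 + 2 * (β * w ^ 2) + 2 + ζ * D₀, by positivity,
    ⌈2 + 8 * w + 2 * (a * w) + 2 * (β * w ^ 2)⌉₊, fun n hn => ?_⟩
  · have h1 : 0 ≤ α * (3 * w ^ 2) + β * (4 * w ^ 2) := by positivity
    have h2 : 0 ≤ ζ * (D₀ + K) := by positivity
    linarith
  have hn' : 2 + 8 * w + 2 * (a * w) + 2 * (β * w ^ 2) ≤ n := Nat.ceil_le.1 hn
  have hβw0 : 0 < β * w ^ 2 := by positivity
  have hn2 : (2 : ℝ) ≤ n := by linarith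
  have hn2' : 2 ≤ n := by exact_mod_cast hn2
  have hn0 : (0 : ℝ) < n := by linarith
  have hn8 : 8 * (w / n) ≤ 1 := by
    rw [← mul_div_assoc, div_le_one hn0]; linarith
  have hna : a * (w / n) ≤ 1 / 2 := by
    rw [← mul_div_assoc, div_le_iff₀ hn0]; linarith
  have hnβ : β * (w ^ 2 / n) ≤ 1 / 2 := by
    rw [← mul_div_assoc, div_le_iff₀ hn0]; linarith
  refine ⟨fun y => α * ∑ j, y j ^ 2 + β * ∑ j, (min (y j) 0) ^ 2 + ∑ j, clampLoad (y j) +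
    ζ * lowPotential a w ε y, fun y => ?_, ?_, fun y p x M hM h hy => ?_⟩
  · have h1 : ∑ _j : Fin n, (-1 : ℝ) ≤ ∑ j, clampLoad (y j) :=
      sum_le_sum fun j _ => neg_one_le_clampLoad _
    have h2 : 0 ≤ ∑ j, y j ^ 2 := sum_nonneg fun j _ => sq_nonneg _
    have h3 : 0 ≤ ∑ j, (min (y j) 0) ^ 2 := sum_nonneg fun j _ => sq_nonneg _
    have h4 := lowPotential_nonneg (w := w) (ε := ε) ha0.le y
    simp only [sum_const, card_univ, Fintype.card_fin, nsmul_eq_mul] at h1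
    have h5 : 0 ≤ α * ∑ j, y j ^ 2 := by positivity
    have h6 : 0 ≤ β * ∑ j, (min (y j) 0) ^ 2 := by positivity
    have h7 : 0 ≤ ζ * lowPotential a w ε y := by positivity
    linarith
  · have h1 : clampLoad 0 = 0 := by norm_num [clampLoad]
    have h2 := mul_le_mul_of_nonneg_left
      (lowPotential_le (a := a) (w := w) (ε := ε) (fun _ : Fin n => (0 : ℝ))) hζ0.le
    simp only [h1, min_self, ne_eq, OfNat.ofNat_ne_zero, not_false_eq_true, zero_pow, sum_const_zero]
    linarith
  -- `ξ` only bounds the increase from above: `lowPotential` can drop by order `n` when many bins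
  -- become underloaded at once, so the true change has no bound of order `M`.
  refine ⟨fun i => α * (∑ j, bump y i (x i) j ^ 2 - ∑ j, y j ^ 2) +
    β * (∑ j, (min (bump y i (x i) j) 0) ^ 2 - ∑ j, (min (y j) 0) ^ 2) +
    (∑ j, clampLoad (bump y i (x i) j) - ∑ j, clampLoad (y j)) +
    ζ * lowIncrease a w ε y i (x i), fun i => ?_, fun i => ?_, ?_⟩
  · have := mul_le_mul_of_nonneg_left (lowPotential_bump_le hn2' ha0.le hε0 hε8 y i
      (h.x_nonneg i) (h.x_le i)) hζ0.le
    simp only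
    linarith
  · have h1 := h.abs_sum_sq_bump_sub_le hM hy i
    have h2 := h.abs_sum_min_sq_bump_sub_le hM hy i (by linarith)
    have h3 := h.abs_sum_clampLoad_bump_sub_le hM i (by linarith)
    have h4 := h.abs_lowIncrease_le ha0.le hε0 hM i
    refine (abs_add_le _ _).trans (le_trans (add_le_add_left ((abs_add_le _ _).trans
      (add_le_add_left (abs_add_le _ _) _)) _) ?_)
    rw [abs_mul, abs_mul, abs_mul, abs_of_pos hα0, abs_of_pos hβ0, abs_of_pos hζ0]
    have := mul_le_mul_of_nonneg_left h1 hα0.le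
    have := mul_le_mul_of_nonneg_left h2 hβ0.le
    have := mul_le_mul_of_nonneg_left h4 hζ0.le
    linarith
  · have hsplit : ∑ i, p i * (α * (∑ j, bump y i (x i) j ^ 2 - ∑ j, y j ^ 2) +
        β * (∑ j, (min (bump y i (x i) j) 0) ^ 2 - ∑ j, (min (y j) 0) ^ 2) +
        (∑ j, clampLoad (bump y i (x i) j) - ∑ j, clampLoad (y j)) +
        ζ * lowIncrease a w ε y i (x i)) =
        α * ∑ i, p i * (∑ j, bump y i (x i) j ^ 2 - ∑ j, y j ^ 2) +
        β * ∑ i, p i * (∑ j, (min (bump y i (x i) j) 0) ^ 2 - ∑ j, (min (y j) 0) ^ 2) +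
        ∑ i, p i * (∑ j, clampLoad (bump y i (x i) j) - ∑ j, clampLoad (y j)) +
        ζ * ∑ i, p i * lowIncrease a w ε y i (x i) :=
      sum_mul_combination p _ _ _ _ α β ζ
    rw [hsplit]
    have hs0 := excess_nonneg (y := y)
    have h1 : α * ∑ i, p i * (∑ j, bump y i (x i) j ^ 2 - ∑ j, y j ^ 2) ≤
        -(2 * α * k * excess y) + 1 / 2 := by
      have := mul_le_mul_of_nonneg_left h.drift_sq hα0.le
      linarith
    have hαs : 0 ≤ 2 * α * k * excess y := by positivity
    have h2 : β * ∑ i, p i * (∑ j, (min (bump y i (x i) j) 0) ^ 2 - ∑ j, (min (y j) 0) ^ 2) ≤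
        2 * (β * w ^ 2) := by
      have := mul_le_mul_of_nonneg_left h.drift_min_sq_le hβ0.le
      linarith
    have h3 := h.drift_clampLoad hn8
    have h3' : 0 ≤ max (overFrac y - 8 * excess y) 0 := le_max_right _ _
    by_cases hlow : overFrac y < ε
    · rw [if_neg (fun hc => absurd hc.1 (not_le.2 hlow))]
      have h4 : ∑ i, p i * lowIncrease a w ε y i (x i) =
          -∑ i, p i * (∑ j, capExp a w (bump y i (x i) j) - ∑ j, capExp a w (y j)) := by
        rw [← sum_neg_distrib]
        refine sum_congr rfl fun i _ => ?_
        rw [lowIncrease, if_pos hlow]; ring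
      have h5 := h.drift_capExp (by linarith) hexp hna
      have h6 : a * w * K * overFrac y ≤ a * w * K * ε := by gcongr
      have h7 : 0 ≤ (∑ i with y i < 0, capExp a w (y i)) / n :=
        div_nonneg (sum_nonneg fun i _ => (capExp_pos _ _ _).le) hn0.le
      rw [h4]
      by_cases hsC : excess y ≤ C
      · have h8 := le_sum_under_capExp h.n_pos h.sum_y ha0.le hw0.le hC0 (by linarith) hsC
        have h9 : 2 * c₂ ≤ (∑ i with y i < 0, capExp a w (y i)) / n := by
          rw [le_div_iff₀ hn0, hc₂]
          linarith
        have h10 : ζ * -∑ i, p i * (∑ j, capExp a w (bump y i (x i) j) - ∑ j, capExp a w (y j)) ≤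
            ζ * -c₂ := mul_le_mul_of_nonneg_left (by linarith) hζ0.le
        linarith
      · have h10 : ζ * -∑ i, p i * (∑ j, capExp a w (bump y i (x i) j) - ∑ j, capExp a w (y j)) ≤
            ζ * c₂ := mul_le_mul_of_nonneg_left (by linarith) hζ0.le
        have h11 : 2 * α * k * C ≤ 2 * α * k * excess y :=
          mul_le_mul_of_nonneg_left (by linarith) (by positivity)
        linarith
    by_cases hhigh : 1 - ε < overFrac y
    · rw [if_neg (fun hc => absurd hc.2 (not_le.2 hhigh))]
      have h4 : ∑ i, p i * lowIncrease a w ε y i (x i) = 0 :=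
        sum_eq_zero fun i _ => by rw [lowIncrease, if_neg hlow, if_pos hhigh, mul_zero]
      rw [h4]
      have h5 := mul_le_mul_of_nonneg_left (h.drift_min_sq_high (by linarith)) hβ0.le
      have h6 : (β * w ^ 2) * (1 - overFrac y) ≤ (β * w ^ 2) * ε := by gcongr; linarith
      have h7 : β * (k * excess y) = 128 * excess y := by rw [← mul_assoc, hβk]
      -- For small excess the clamped loads decide: their drift is at most `2 - 8 * (7 / 8 - 1 / 4)
      -- = -3`.
      by_cases hs : excess y ≤ 1 / 32
      · have h8 : overFrac y - 8 * excess y ≤ max (overFrac y - 8 * excess y) 0 := le_max_left _ _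
        linarith
      · linarith
    · rw [if_pos ⟨not_lt.1 hlow, not_lt.1 hhigh⟩]
      have h4 : ∑ i, p i * lowIncrease a w ε y i (x i) = D₀ := by
        rw [← h.sum_p_mul_const D₀]
        exact sum_congr rfl fun i _ => by rw [lowIncrease, if_neg hlow, if_neg hhigh]
      rw [h4]
      linarith

end

/-! ### Comparison with independent binomials, and exponential moments -/

noncomputable section

/-- A Weierstrass type inequality. -/
theorem prod_sub_sum_le_prod {ι : Type*} [DecidableEq ι] (s : Finset ι) {f e : ι → ℝ} {a : ℝ}
    (ha0 : 0 ≤ a) (ha1 : a ≤ 1) (he : ∀ i, 0 ≤ e i) (hef : ∀ i, e i ≤ f i) :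
    ∏ i ∈ s, f i - a * ∑ j ∈ s, (∏ i ∈ s, f i - ∏ i ∈ s, if i = j then e i else f i) ≤
      ∏ i ∈ s, ((1 - a) * f i + a * e i) := by
  induction s using Finset.induction_on with
  | empty => simp
  | insert k s hk ih =>
    have h1 : ∏ i ∈ insert k s, (if i = k then e i else f i) = e k * ∏ i ∈ s, f i := by
      rw [prod_insert hk, if_pos rfl]
      congr 1
      exact prod_congr rfl fun i hi => if_neg (by rintro rfl; exact hk hi)
    have h2 : ∀ j ∈ s, ∏ i ∈ insert k s, (if i = j then e i else f i) =
        f k * ∏ i ∈ s, if i = j then e i else f i := fun j hj => by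
      rw [prod_insert hk, if_neg (by rintro rfl; exact hk hj)]
    rw [sum_insert hk, h1, sum_congr rfl (fun j hj => by rw [h2 j hj]), prod_insert hk,
      prod_insert hk]
    simp_rw [← mul_sub]
    rw [← mul_sum]
    set Q := ∏ i ∈ s, f i
    set S := ∑ j ∈ s, (Q - ∏ i ∈ s, if i = j then e i else f i)
    have hS : 0 ≤ S := sum_nonneg fun j _ => sub_nonneg.2 <| prod_le_prod
      (fun i _ => by split_ifs; exacts [he i, (he i).trans (hef i)])
      (fun i _ => by split_ifs; exacts [hef i, le_rfl])
    have hk0 : 0 ≤ (1 - a) * f k + a * e k := by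
      have := (he k).trans (hef k)
      have := he k
      have : 0 ≤ 1 - a := by linarith
      positivity
    refine le_trans ?_ (mul_le_mul_of_nonneg_left ih hk0)
    have : 0 ≤ a * a * (f k - e k) * S := by
      have : 0 ≤ f k - e k := sub_nonneg.2 (hef k)
      positivity
    nlinarith

/-- A single allocation hits exactly one bin, so the left side is linear in `p` and largest when `p`
is lowered to `a`. It is then the first-order expansion of the product, which describes bins hit
independently with probability `a`. -/
theorem sum_mul_prod_le {ι : Type*} [Fintype ι] [DecidableEq ι] {p f e : ι → ℝ} {a : ℝ}
    (ha0 : 0 ≤ a) (ha1 : a ≤ 1) (he : ∀ i, 0 ≤ e i) (hef : ∀ i, e i ≤ f i) (hp : ∀ i, a ≤ p i)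
    (hp1 : ∑ i, p i = 1) :
    ∑ j, p j * ∏ i, (if i = j then e i else f i) ≤ ∏ i, ((1 - a) * f i + a * e i) := by
  refine le_trans ?_ (prod_sub_sum_le_prod univ ha0 ha1 he hef)
  have h1 : ∑ j, p j * ∏ i, (if i = j then e i else f i) =
      ∏ i, f i - ∑ j, p j * (∏ i, f i - ∏ i, if i = j then e i else f i) := by
    simp_rw [mul_sub, sum_sub_distrib, ← sum_mul, hp1]
    ring
  rw [h1, mul_sum]
  refine sub_le_sub_left (sum_le_sum fun j _ => mul_le_mul_of_nonneg_right (hp j) ?_) _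
  exact sub_nonneg.2 <| prod_le_prod
    (fun i _ => by split_ifs; exacts [he i, (he i).trans (hef i)])
    (fun i _ => by split_ifs; exacts [hef i, le_rfl])

/-- The probability that `x` plus a binomial variable with parameters `g` and `a` is less
than `M`. -/
def binomialBelow (a : ℝ) (M : ℕ) : ℕ → ℕ → ℝ
  | 0, x => if x < M then 1 else 0
  | g + 1, x => (1 - a) * binomialBelow a M g x + a * binomialBelow a M g (x + 1)

section binomialBelow

variable {a : ℝ} {M : ℕ}

theorem binomialBelow_nonneg (ha0 : 0 ≤ a) (ha1 : a ≤ 1) (g x : ℕ) :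
    0 ≤ binomialBelow a M g x := by
  induction g generalizing x with
  | zero => unfold binomialBelow; split_ifs <;> norm_num
  | succ g ih =>
    have h1 : 0 ≤ 1 - a := by linarith
    have h2 := ih x
    have h3 := ih (x + 1)
    unfold binomialBelow
    positivity

theorem binomialBelow_antitone (ha0 : 0 ≤ a) (ha1 : a ≤ 1) (g : ℕ) :
    Antitone (binomialBelow a M g) := by
  induction g with
  | zero =>
    intro x y hxy
    simp only [binomialBelow]
    split_ifs <;> first | omega | norm_num
  | succ g ih =>
    intro x y hxy
    simp only [binomialBelow]
    have h1 : 0 ≤ 1 - a := by linarith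
    exact add_le_add (mul_le_mul_of_nonneg_left (ih hxy) h1)
      (mul_le_mul_of_nonneg_left (ih (by omega)) ha0)

theorem binomialBelow_of_le (g x : ℕ) (hx : M ≤ x) : binomialBelow a M g x = 0 := by
  induction g generalizing x with
  | zero => simp [binomialBelow, hx]
  | succ g ih => simp [binomialBelow, ih x hx, ih (x + 1) (by omega)]

/-- At least `k` successes are no less likely than exactly `k`. The exponent `g` in place of `g - k`
only weakens the bound and avoids subtraction in the induction. -/
theorem le_one_sub_binomialBelow (ha0 : 0 ≤ a) (ha1 : a ≤ 1) (g k x : ℕ) (hx : x + k = M) :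
    (g.choose k : ℝ) * a ^ k * (1 - a) ^ g ≤ 1 - binomialBelow a M g x := by
  have h1a : 0 ≤ 1 - a := by linarith
  induction g generalizing x k with
  | zero =>
    cases k with
    | zero => simp [binomialBelow_of_le (a := a) 0 x (show M ≤ x by omega)]
    | succ k => simp [binomialBelow, show x < M by omega]
  | succ g ih =>
    cases k with
    | zero =>
      rw [binomialBelow_of_le _ _ (by omega)]
      simpa using pow_le_one₀ h1a (by linarith)
    | succ k =>
      have h1 := ih (k + 1) x hx
      have h2 := ih k (x + 1) (by omega)
      have h3 : (1 - a) ^ (g + 1) ≤ (1 - a) ^ g := pow_le_pow_of_le_one h1a (by linarith) (by omega)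
      have h4 := mul_le_mul_of_nonneg_left h1 h1a
      have h5 := mul_le_mul_of_nonneg_left h2 ha0
      have h6 : (g.choose k : ℝ) * a ^ (k + 1) * (1 - a) ^ (g + 1) ≤
          (g.choose k : ℝ) * a ^ (k + 1) * (1 - a) ^ g := by gcongr
      rw [Nat.choose_succ_succ, binomialBelow]
      push_cast
      calc ((g.choose k : ℝ) + g.choose (k + 1)) * a ^ (k + 1) * (1 - a) ^ (g + 1)
          = (g.choose k : ℝ) * a ^ (k + 1) * (1 - a) ^ (g + 1) +
            (1 - a) * ((g.choose (k + 1) : ℝ) * a ^ (k + 1) * (1 - a) ^ g) := by ring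
        _ ≤ a * ((g.choose k : ℝ) * a ^ k * (1 - a) ^ g) +
            (1 - a) * ((g.choose (k + 1) : ℝ) * a ^ (k + 1) * (1 - a) ^ g) := by
            refine add_le_add_left (h6.trans (le_of_eq ?_)) _
            ring
        _ ≤ _ := by linarith

end binomialBelow

/-- The exponential moment of a bounded random variable of mean at most `μ`. -/
theorem sum_mul_exp_le {ι : Type*} [Fintype ι] {p ξ : ι → ℝ} {b μ l : ℝ} (hp0 : ∀ i, 0 ≤ p i)
    (hp1 : ∑ i, p i = 1) (hξ : ∀ i, |ξ i| ≤ b) (hμ : ∑ i, p i * ξ i ≤ μ) (hl : 0 ≤ l)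
    (hlb : l * b ≤ 1) : ∑ i, p i * Real.exp (l * ξ i) ≤ Real.exp (l * μ + (l * b) ^ 2) := by
  have h1 : ∀ i, Real.exp (l * ξ i) ≤ 1 + l * ξ i + (l * b) ^ 2 := fun i => by
    have h2 : |l * ξ i| ≤ l * b := by
      rw [abs_mul, abs_of_nonneg hl]
      exact mul_le_mul_of_nonneg_left (hξ i) hl
    have h3 := (abs_le.1 (Real.abs_exp_sub_one_sub_id_le (h2.trans hlb))).2
    have h4 := sq_le_sq' (by linarith [(abs_le.1 h2).1]) (abs_le.1 h2).2
    linarith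
  calc ∑ i, p i * Real.exp (l * ξ i) ≤ ∑ i, p i * (1 + l * ξ i + (l * b) ^ 2) :=
        sum_le_sum fun i _ => mul_le_mul_of_nonneg_left (h1 i) (hp0 i)
    _ = 1 + l * ∑ i, p i * ξ i + (l * b) ^ 2 := by
        simp_rw [mul_add, sum_add_distrib, ← sum_mul, hp1, mul_sum]
        simp only [one_mul, add_left_inj, add_right_inj]
        exact sum_congr rfl fun i _ => by ring
    _ ≤ l * μ + (l * b) ^ 2 + 1 := by linarith [mul_le_mul_of_nonneg_left hμ hl]
    _ ≤ _ := Real.add_one_le_exp _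

namespace AllocationProcess

variable {n : ℕ} (P : AllocationProcess n)

theorem overloaded_eq (h : List (Fin n)) :
    P.overloaded h = ({i | 0 ≤ P.normLoad h i} : Finset (Fin n)) := rfl

theorem underloaded_eq (h : List (Fin n)) :
    P.underloaded h = ({i | P.normLoad h i < 0} : Finset (Fin n)) := rfl

theorem quantile_eq (h : List (Fin n)) : P.quantile h = overFrac (P.normLoad h) := rfl

/-! ### Both sets of conditions give a biased step -/

section biasedStep

variable {P} {k₁ wPlus wMinus : ℕ} {k₂ k₃ k₄ : ℝ} {h : List (Fin n)}

theorem CondW1.weight_bounds (hW : P.CondW1 wPlus wMinus) (hh : P.Possible h) (i : Fin n) :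
    wPlus ≤ P.weight h i ∧ P.weight h i ≤ wMinus := by
  have := hW.le
  rcases le_or_gt 0 (P.normLoad h i) with hi | hi
  · rw [hW.weight_over h hh i (by simpa [overloaded] using hi)]; exact ⟨le_rfl, this⟩
  · rw [hW.weight_under h hh i (by simpa [underloaded] using hi)]; exact ⟨this, le_rfl⟩

theorem CondW1.sum_weight_mul (hW : P.CondW1 wPlus wMinus) (hh : P.Possible h) (f : Fin n → ℝ) :
    ∑ i, P.binProb h i * (P.weight h i * f i) =
      wPlus * ∑ i with 0 ≤ P.normLoad h i, P.binProb h i * f i +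
        wMinus * ∑ i with P.normLoad h i < 0, P.binProb h i * f i := by
  rw [← sum_over_add_sum_under (y := P.normLoad h), mul_sum, mul_sum]
  congr 1
  · refine sum_congr rfl fun i hi => ?_
    rw [hW.weight_over h hh i hi]; ring
  · refine sum_congr rfl fun i hi => ?_
    rw [hW.weight_under h hh i hi]; ring

/-- Here the bias lies in the probabilities: the gains `k₃ * (1 - δ)` and `k₄ * δ` together are at
least `min k₃ k₄`. For `high`, the factor `1 + k₄ * δ` on the deficit drop beats the mean weight,
which is at most `wMinus`. -/
theorem biasedStep_of_condP2 (hn : 0 < n) (hk₃ : k₃ ∈ Set.Ioc (0 : ℝ) 1)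
    (hk₄ : k₄ ∈ Set.Ioc (0 : ℝ) 1) (hP : P.CondP2 k₁ k₂ k₃ k₄) (hW : P.CondW1 wPlus wMinus)
    (hh : P.Possible h) :
    BiasedStep (P.normLoad h) (P.binProb h) (fun i => (P.weight h i : ℝ)) wMinus k₂
      (min k₃ k₄) := by
  have hn0 : (0 : ℝ) < n := by exact_mod_cast hn
  have hv : (1 : ℝ) ≤ wPlus := by exact_mod_cast hW.one_le
  have hvw : (wPlus : ℝ) ≤ wMinus := by exact_mod_cast hW.le
  have hw0 : (0 : ℝ) ≤ wMinus := by positivity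
  have hδ0 := overFrac_nonneg (y := P.normLoad h)
  have hδ1 := overFrac_le_one (y := P.normLoad h) hn
  have hs := excess_nonneg (y := P.normLoad h)
  have hsum := P.sum_normLoad hn h
  have hm3 := min_le_left k₃ k₄
  have hm4 := min_le_right k₃ k₄
  have hm0 : 0 < min k₃ k₄ := lt_min hk₃.1 hk₄.1
  have hover := P.sum_overloaded_le_of_majorizes (hP.over_maj h hh) (φ := id)
    (monotone_id.monotoneOn _) (fun r hr => hr)
  have hunder := P.le_sum_underloaded_of_majorizes (hP.under_maj h hh) (φ := id)
    (monotone_id.monotoneOn _) (fun r hr => hr)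
  have hdrop := P.le_sum_underloaded_of_majorizes (hP.under_maj h hh)
    (deficitDrop_monotoneOn hw0) (fun r hr => deficitDrop_nonneg hw0 hr)
  simp only [id_eq, overloaded_eq, underloaded_eq, quantile_eq] at hover hunder hdrop
  have hψ0 : 0 ≤ ∑ i with P.normLoad h i < 0, deficitDrop wMinus (-P.normLoad h i) :=
    sum_nonneg fun i hi => deficitDrop_nonneg hw0 (by
      have : P.normLoad h i < 0 := by simpa using hi
      linarith)
  have hψ1 : n * (2 * wMinus * excess (P.normLoad h)) -
      n * (1 - overFrac (P.normLoad h)) * (wMinus : ℝ) ^ 2 ≤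
      ∑ i with P.normLoad h i < 0, deficitDrop wMinus (-P.normLoad h i) := by
    have h3 : ∑ i with P.normLoad h i < 0, (2 * (wMinus : ℝ) * -P.normLoad h i - (wMinus : ℝ) ^ 2) ≤
        ∑ i with P.normLoad h i < 0, deficitDrop wMinus (-P.normLoad h i) :=
      sum_le_sum fun i _ => le_deficitDrop _ _
    rw [sum_sub_distrib, ← mul_sum, sum_under_eq hn hsum, sum_const, nsmul_eq_mul,
      card_under hn] at h3
    linarith
  rw [sum_over_eq hn] at hover
  rw [sum_under_eq hn hsum] at hunder
  set s := excess (P.normLoad h)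
  set δ := overFrac (P.normLoad h)
  set ψ := ∑ i with P.normLoad h i < 0, deficitDrop wMinus (-P.normLoad h i)
  have hover' : ∑ i with 0 ≤ P.normLoad h i, P.binProb h i * P.normLoad h i ≤
      (1 - k₃ * (1 - δ)) * s := hover.trans (le_of_eq (by field_simp))
  have hunder' : ∑ i with P.normLoad h i < 0, P.binProb h i * P.normLoad h i ≤
      -((1 + k₄ * δ) * s) := by
    have : ∑ i with P.normLoad h i < 0, P.binProb h i * P.normLoad h i =
        -∑ i with P.normLoad h i < 0, P.binProb h i * -P.normLoad h i := by
      rw [← sum_neg_distrib]; simp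
    rw [this]
    refine neg_le_neg (le_trans (le_of_eq ?_) hunder)
    field_simp
  have hdrop' : (1 + k₄ * δ) * (ψ / n) ≤
      ∑ i with P.normLoad h i < 0, P.binProb h i * deficitDrop wMinus (-P.normLoad h i) := by
    refine le_trans (le_of_eq ?_) hdrop
    field_simp
  have hψn : 0 ≤ ψ / n := by positivity
  have hk4δ : 0 ≤ k₄ * δ := mul_nonneg hk₄.1.le hδ0
  have hk3δ : 0 ≤ k₃ * (1 - δ) := mul_nonneg hk₃.1.le (by linarith)
  refine ⟨hn, P.binProb_nonneg h, P.sum_binProb h, hsum, fun i => ?_, fun i => ?_, fun i hi => ?_,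
    fun i hi => hP.le_under h hh i (by simpa [underloaded] using hi), ?_, ?_, fun hδ => ?_⟩
  · exact_mod_cast hW.one_le.trans (hW.weight_bounds hh i).1
  · exact_mod_cast (hW.weight_bounds hh i).2
  · rw [hW.weight_under h hh i (by simpa [underloaded] using hi)]
  · rw [hW.sum_weight_mul hh]
    have h1 := mul_le_mul_of_nonneg_left hover' (show (0 : ℝ) ≤ wPlus by linarith)
    have h2 := mul_le_mul_of_nonneg_left hunder' hw0
    have h3 : (wPlus : ℝ) * s ≤ wMinus * s := by gcongr
    have h4 : min k₃ k₄ * s * (1 - δ) ≤ wPlus * (k₃ * (1 - δ) * s) := by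
      calc min k₃ k₄ * s * (1 - δ) ≤ k₃ * s * (1 - δ) := by gcongr
        _ = 1 * (k₃ * (1 - δ) * s) := by ring
        _ ≤ _ := by gcongr
    have h5 : min k₃ k₄ * s * δ ≤ wMinus * (k₄ * δ * s) := by
      calc min k₃ k₄ * s * δ ≤ k₄ * s * δ := by gcongr
        _ = 1 * (k₄ * δ * s) := by ring
        _ ≤ _ := by gcongr; linarith
    linarith
  · have : 0 ≤ k₄ * δ * (ψ / n) := by positivity
    linarith
  · have h1 : ∑ i, P.binProb h i * (P.weight h i : ℝ) ≤ wMinus := by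
      calc ∑ i, P.binProb h i * (P.weight h i : ℝ) ≤ ∑ i, P.binProb h i * wMinus := by
            refine sum_le_sum fun i _ => mul_le_mul_of_nonneg_left ?_ (P.binProb_nonneg h i)
            exact_mod_cast (hW.weight_bounds hh i).2
        _ = wMinus := by rw [← sum_mul, P.sum_binProb, one_mul]
    have h2 := mul_le_mul_of_nonneg_right h1 hs
    have h3 : 2 * wMinus * s - (1 - δ) * (wMinus : ℝ) ^ 2 ≤ ψ / n := by
      rw [le_div_iff₀ hn0]; linarith
    have h4 := mul_le_mul_of_nonneg_left h3 (show 0 ≤ 1 + k₄ * δ by linarith)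
    have h5 : k₄ * δ ≤ 1 := by nlinarith [hk₄.2]
    have h6 : 0 ≤ (1 - δ) * (wMinus : ℝ) ^ 2 := by
      have : 0 ≤ 1 - δ := by linarith
      positivity
    have h7 : min k₃ k₄ * s ≤ k₄ * δ * (2 * wMinus * s) := by
      have h8 : k₄ ≤ k₄ * δ * (2 * wMinus) := by
        have : 1 ≤ δ * (2 * wMinus) := by nlinarith
        nlinarith [hk₄.1]
      calc min k₃ k₄ * s ≤ k₄ * s := by gcongr
        _ ≤ k₄ * δ * (2 * wMinus) * s := by gcongr
        _ = _ := by ring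
    nlinarith [mul_le_mul_of_nonneg_right h5 h6]

/-- Here the bias lies in the weights, which differ by at least 1. For `high`, let `q` be the
probability of an underloaded bin. If `q ≥ 2 * (1 - δ)`, the additional majorization at least
doubles the uniform deficit drop. Otherwise `q < 1 / 2`, so the mean weight is at most `wMinus - 1 /
2` and the mean rises more slowly. -/
theorem biasedStep_of_condW2 (hn : 0 < n) {k : ℝ} (hk : k ≤ 1) (hP : P.CondP1 k₁ k₂)
    (hW : P.CondW2 wPlus wMinus) (hh : P.Possible h) :
    BiasedStep (P.normLoad h) (P.binProb h) (fun i => (P.weight h i : ℝ)) wMinus k₂ k := by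
  have hW1 := hW.toCondW1
  have hn0 : (0 : ℝ) < n := by exact_mod_cast hn
  have hv : (1 : ℝ) ≤ wPlus := by exact_mod_cast hW1.one_le
  have hvw : (wPlus : ℝ) + 1 ≤ wMinus := by exact_mod_cast hW.lt
  have hw0 : (0 : ℝ) ≤ wMinus := by positivity
  have hδ0 := overFrac_nonneg (y := P.normLoad h)
  have hδ1 := overFrac_le_one (y := P.normLoad h) hn
  have hs := excess_nonneg (y := P.normLoad h)
  have hsum := P.sum_normLoad hn h
  have hover := P.sum_overloaded_le_of_majorizes (hP.over_maj h hh) (φ := id)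
    (monotone_id.monotoneOn _) (fun r hr => hr)
  have hunder := P.le_sum_underloaded_of_majorizes (hP.under_maj h hh) (φ := id)
    (monotone_id.monotoneOn _) (fun r hr => hr)
  have hdrop := P.le_sum_underloaded_of_majorizes (hP.under_maj h hh)
    (deficitDrop_monotoneOn hw0) (fun r hr => deficitDrop_nonneg hw0 hr)
  have hdrop2 := P.le_sum_underloaded_of_majorizes (hW.under_maj h hh)
    (deficitDrop_monotoneOn hw0) (fun r hr => deficitDrop_nonneg hw0 hr)
  simp only [id_eq, overloaded_eq, underloaded_eq] at hover hunder hdrop hdrop2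
  have hψ0 : 0 ≤ ∑ i with P.normLoad h i < 0, deficitDrop wMinus (-P.normLoad h i) :=
    sum_nonneg fun i hi => deficitDrop_nonneg hw0 (by
      have : P.normLoad h i < 0 := by simpa using hi
      linarith)
  have hψ1 : n * (2 * wMinus * excess (P.normLoad h)) -
      n * (1 - overFrac (P.normLoad h)) * (wMinus : ℝ) ^ 2 ≤
      ∑ i with P.normLoad h i < 0, deficitDrop wMinus (-P.normLoad h i) := by
    have h3 : ∑ i with P.normLoad h i < 0, (2 * (wMinus : ℝ) * -P.normLoad h i - (wMinus : ℝ) ^ 2) ≤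
        ∑ i with P.normLoad h i < 0, deficitDrop wMinus (-P.normLoad h i) :=
      sum_le_sum fun i _ => le_deficitDrop _ _
    rw [sum_sub_distrib, ← mul_sum, sum_under_eq hn hsum, sum_const, nsmul_eq_mul,
      card_under hn] at h3
    linarith
  rw [sum_over_eq hn] at hover
  rw [sum_under_eq hn hsum] at hunder
  rw [card_under hn] at hdrop2
  have hq : ∑ i with 0 ≤ P.normLoad h i, P.binProb h i = 1 - P.underProb h := by
    have := sum_over_add_sum_under (y := P.normLoad h) (P.binProb h)
    rw [P.sum_binProb] at this
    unfold underProb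
    rw [underloaded_eq]
    linarith
  have hq0 : 0 ≤ P.underProb h := sum_nonneg fun i _ => P.binProb_nonneg h i
  have hmean : ∑ i, P.binProb h i * (P.weight h i : ℝ) =
      wPlus * (1 - P.underProb h) + wMinus * P.underProb h := by
    have := hW1.sum_weight_mul hh (fun _ => 1)
    simp only [mul_one] at this
    rw [this, hq, underProb, underloaded_eq]
  set s := excess (P.normLoad h)
  set δ := overFrac (P.normLoad h)
  set q := P.underProb h
  set ψ := ∑ i with P.normLoad h i < 0, deficitDrop wMinus (-P.normLoad h i)
  have hover' : ∑ i with 0 ≤ P.normLoad h i, P.binProb h i * P.normLoad h i ≤ s :=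
    hover.trans (le_of_eq (by field_simp))
  have hunder' : ∑ i with P.normLoad h i < 0, P.binProb h i * P.normLoad h i ≤ -s := by
    have : ∑ i with P.normLoad h i < 0, P.binProb h i * P.normLoad h i =
        -∑ i with P.normLoad h i < 0, P.binProb h i * -P.normLoad h i := by
      rw [← sum_neg_distrib]; simp
    rw [this]
    refine neg_le_neg (le_trans (le_of_eq ?_) hunder)
    field_simp
  have hdrop' : ψ / n ≤
      ∑ i with P.normLoad h i < 0, P.binProb h i * deficitDrop wMinus (-P.normLoad h i) := by
    refine le_trans (le_of_eq ?_) hdrop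
    ring
  have hψn : 0 ≤ ψ / n := by positivity
  have hks : k * s ≤ s := mul_le_of_le_one_left hs hk
  refine ⟨hn, P.binProb_nonneg h, P.sum_binProb h, hsum, fun i => ?_, fun i => ?_, fun i hi => ?_,
    fun i hi => hP.le_under h hh i (by simpa [underloaded] using hi), ?_, hdrop', fun hδ => ?_⟩
  · exact_mod_cast hW1.one_le.trans (hW1.weight_bounds hh i).1
  · exact_mod_cast (hW1.weight_bounds hh i).2
  · rw [hW1.weight_under h hh i (by simpa [underloaded] using hi)]
  · rw [hW1.sum_weight_mul hh]
    have h1 := mul_le_mul_of_nonneg_left hover' (show (0 : ℝ) ≤ wPlus by linarith)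
    have h2 := mul_le_mul_of_nonneg_left hunder' hw0
    have h3 : ((wPlus : ℝ) + 1) * s ≤ wMinus * s := by gcongr
    linarith
  · have h3 : 2 * wMinus * s - (1 - δ) * (wMinus : ℝ) ^ 2 ≤ ψ / n := by
      rw [le_div_iff₀ hn0]; linarith
    have hu0 : 0 ≤ 1 - δ := by linarith
    have h6 : 0 ≤ (1 - δ) * (wMinus : ℝ) ^ 2 := by positivity
    change 2 * (∑ i, P.binProb h i * (P.weight h i : ℝ)) * s - _ ≤ _
    rw [hmean]
    rcases le_or_gt (2 * (1 - δ)) q with hqu | hqu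
    · rcases hu0.eq_or_lt with hu | hu
      · have hs0 : s = 0 := by
          have hempty : #{i | P.normLoad h i < 0} = 0 := by
            have : (#{i | P.normLoad h i < 0} : ℝ) = 0 := by rw [card_under hn, ← hu, mul_zero]
            exact_mod_cast this
          have h7 := sum_under_eq hn hsum
          rw [card_eq_zero.1 hempty, sum_empty] at h7
          rcases mul_eq_zero.1 h7.symm with h8 | h8
          · linarith
          · exact h8
        rw [hs0]
        linarith
      · have h7 : 2 * (ψ / n) ≤ q / (n * (1 - δ)) * ψ := by
          have : 2 / n ≤ q / (n * (1 - δ)) := by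
            rw [div_le_div_iff₀ hn0 (by positivity)]
            nlinarith
          calc 2 * (ψ / n) = 2 / n * ψ := by ring
            _ ≤ _ := by gcongr
        have h8 : (wPlus * (1 - q) + wMinus * q) * s ≤ wMinus * s := by
          have : q ≤ 1 := by
            have : 0 ≤ 1 - q := hq ▸ sum_nonneg fun i _ => P.binProb_nonneg h i
            linarith
          gcongr
          nlinarith
        have h9 : s ≤ wMinus * s := le_mul_of_one_le_left hs (by linarith)
        linarith
    · have h7 : (wPlus * (1 - q) + wMinus * q) ≤ wMinus - 1 / 2 := by nlinarith
      have h8 := mul_le_mul_of_nonneg_right h7 hs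
      linarith

end biasedStep

/-! ### The number of rounds with a balanced quantile -/

open Classical in
/-- The number of rounds in which the mean quantile was in `[ε, 1 - ε]`. -/
def goodCount (ε : ℝ) : List (Fin n) → ℕ
  | [] => 0
  | _ :: h => goodCount ε h + if P.quantile h ∈ Set.Icc ε (1 - ε) then 1 else 0

theorem load_le_load_cons (i : Fin n) (h : List (Fin n)) (j : Fin n) :
    P.load h j ≤ P.load (i :: h) j := by
  rw [load_cons]; exact Nat.le_add_right _ _

theorem abs_normLoad_le {h : List (Fin n)} {M : ℕ} (hM : ∀ i, P.load h i < M) (i : Fin n) :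
    |P.normLoad h i| ≤ M := by
  have hn : (0 : ℝ) < n := by exact_mod_cast (Nat.pos_of_ne_zero fun h0 => by subst h0; exact i.elim0)
  have h1 : (P.load h i : ℝ) ≤ M := by exact_mod_cast (hM i).le
  have h2 : (P.total h : ℝ) / n ≤ M := by
    rw [div_le_iff₀ hn]
    have : P.total h ≤ ∑ _i : Fin n, M := sum_le_sum fun i _ => (hM i).le
    simp only [sum_const, card_univ, Fintype.card_fin, smul_eq_mul] at this
    have : (P.total h : ℝ) ≤ n * M := by exact_mod_cast this
    linarith
  have h3 : 0 ≤ (P.total h : ℝ) / n := by positivity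
  have h4 : (0 : ℝ) ≤ P.load h i := by positivity
  rw [normLoad, abs_le]
  constructor <;> linarith

/-- As long as all loads are less than `M`, the quantile is balanced in many rounds. -/
theorem pr_goodCount_lt_le {ε B C₀ D : ℝ} {F : (Fin n → ℝ) → ℝ} {M : ℕ} (hB : 1 ≤ B)
    (hM : 1 ≤ M) (hF : ∀ y, -(n : ℝ) ≤ F y) (hF0 : F (fun _ => 0) ≤ C₀ * n) (hD : 0 ≤ D)
    (hstep : ∀ h, P.Possible h → (∀ i, P.load h i < M) → ∃ ξ : Fin n → ℝ,
      (∀ i, F (P.normLoad (i :: h)) ≤ F (P.normLoad h) + ξ i) ∧ (∀ i, |ξ i| ≤ B * M) ∧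
      ∑ i, P.binProb h i * ξ i ≤
        if P.quantile h ∈ Set.Icc ε (1 - ε) then D else -(1 / 2)) (t : ℕ) {g : ℝ} :
    P.pr t {h | (∀ i, P.load h i < M) ∧ (P.goodCount ε h : ℝ) < g} ≤
      Real.exp (1 / (4 * (B * M) ^ 2) * ((C₀ + 1) * n - t / 4 + (D + 1 / 2) * g)) := by
  classical
  have hM' : (1 : ℝ) ≤ M := by exact_mod_cast hM
  have hBM : 1 ≤ B * M := one_le_mul_of_one_le_of_one_le hB hM'
  -- The second-order term `(l * (B * M)) ^ 2` is then exactly `l / 4`. Together with the `1 / 4`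
  -- per round in `E` it uses up the drift `-1 / 2`.
  set l := 1 / (4 * (B * M) ^ 2) with hl
  have hl0 : 0 < l := by positivity
  have hl1 : (l * (B * M)) ^ 2 = l * (1 / 4) := by rw [hl]; field_simp
  have hl2 : l * (B * M) ≤ 1 := by
    rw [hl, div_mul_eq_mul_div, div_le_one (by positivity)]
    nlinarith
  set E : List (Fin n) → ℝ := fun h =>
    F (P.normLoad h) + h.length / 4 - (D + 1 / 2) * P.goodCount ε h + n - t / 4 + (D + 1 / 2) * g
    with hE
  -- The increments are controlled only while all loads are below `M`. Loads never decrease, so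
  -- setting `Φ` to zero afterwards keeps it a supermartingale.
  let Φ : List (Fin n) → ℝ := fun h => if ∀ i, P.load h i < M then Real.exp (l * E h) else 0
  refine (P.pr_le_of_supermartingale (Φ := Φ) (fun h => ?_) (fun h hh => ?_)
    (fun h hh hs => ?_)).trans ?_
  · simp only [Φ]; split_ifs
    · exact (Real.exp_pos _).le
    · exact le_rfl
  · by_cases hload : ∀ i, P.load h i < M
    · obtain ⟨ξ, h1, h2, h3⟩ := hstep h hh hload
      have h4 := sum_mul_exp_le (P.binProb_nonneg h) (P.sum_binProb h) h2 h3 hl0.le hl2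
      have h5 : Φ h = Real.exp (l * E h) := if_pos hload
      set c : ℝ := 1 / 4 - (D + 1 / 2) * (if P.quantile h ∈ Set.Icc ε (1 - ε) then 1 else 0)
        with hc
      have h6 : ∀ i, Φ (i :: h) ≤ Real.exp (l * (E h + c)) * Real.exp (l * ξ i) := fun i => by
        rw [← Real.exp_add]
        simp only [Φ]
        split_ifs with hi
        · refine Real.exp_le_exp.2 ?_
          rw [← mul_add]
          refine mul_le_mul_of_nonneg_left ?_ hl0.le
          simp only [hE, hc, goodCount, List.length_cons]
          push_cast
          linarith [h1 i]
        · exact (Real.exp_pos _).le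
      calc ∑ i, P.binProb h i * Φ (i :: h)
          ≤ ∑ i, P.binProb h i * (Real.exp (l * (E h + c)) * Real.exp (l * ξ i)) :=
            sum_le_sum fun i _ => mul_le_mul_of_nonneg_left (h6 i) (P.binProb_nonneg h i)
        _ = Real.exp (l * (E h + c)) * ∑ i, P.binProb h i * Real.exp (l * ξ i) := by
            rw [mul_sum]; exact sum_congr rfl fun i _ => by ring
        _ ≤ Real.exp (l * (E h + c)) * Real.exp (l * (if P.quantile h ∈ Set.Icc ε (1 - ε) then D
              else -(1 / 2)) + (l * (B * M)) ^ 2) :=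
            mul_le_mul_of_nonneg_left h4 (Real.exp_pos _).le
        _ ≤ Φ h := by
            rw [h5, ← Real.exp_add, hl1, ← mul_add, ← mul_add]
            refine Real.exp_le_exp.2 (mul_le_mul_of_nonneg_left ?_ hl0.le)
            rw [hc]
            split_ifs <;> linarith
    · have h1 : ∀ i, Φ (i :: h) = 0 := fun i => if_neg fun hc =>
        hload fun j => (P.load_le_load_cons i h j).trans_lt (hc j)
      simp only [h1, mul_zero, sum_const_zero, Φ, if_neg hload, le_refl]
  · have h1 : Φ h = Real.exp (l * E h) := if_pos hh.1
    rw [h1]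
    refine Real.one_le_exp (mul_nonneg hl0.le ?_)
    have h2 := hF (P.normLoad h)
    have h3 : (D + 1 / 2) * P.goodCount ε h ≤ (D + 1 / 2) * g :=
      mul_le_mul_of_nonneg_left hh.2.le (by linarith)
    simp only [hE, P.length_of_mem_support_law hs]
    linarith
  · have h0 : P.normLoad [] = fun _ => 0 := funext P.normLoad_nil
    have h1 : Φ [] = Real.exp (l * E []) := if_pos fun i => by
      simp only [load, loadVec]; omega
    rw [h1]
    refine Real.exp_le_exp.2 (mul_le_mul_of_nonneg_left ?_ hl0.le)
    simp only [hE, h0, goodCount, List.length_nil]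
    push_cast
    linarith

/-- If the quantile is balanced in `g` rounds, then the bins are at least as full as if they were
filled according to independent binomial variables. -/
theorem pr_le_binomialBelow_pow {ε a : ℝ} {M : ℕ} (ha0 : 0 ≤ a) (ha1 : a ≤ 1)
    (hw : ∀ h, P.Possible h → ∀ i, 1 ≤ P.weight h i)
    (hgood : ∀ h, P.Possible h → P.quantile h ∈ Set.Icc ε (1 - ε) → ∀ i, a ≤ P.binProb h i)
    (t g : ℕ) :
    P.pr t {h | (∀ i, P.load h i < M) ∧ g ≤ P.goodCount ε h} ≤ binomialBelow a M g 0 ^ n := by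
  classical
  -- Each bin keeps one independent trial for every balanced round still missing. By truncated
  -- subtraction no trials are left after the `g`-th one, and `Φ` is then the indicator that all
  -- loads are below `M`.
  let Φ : List (Fin n) → ℝ := fun h => ∏ i, binomialBelow a M (g - P.goodCount ε h) (P.load h i)
  refine (P.pr_le_of_supermartingale (Φ := Φ) (fun h => ?_) (fun h hh => ?_)
    (fun h hh hs => ?_)).trans (le_of_eq ?_)
  · exact prod_nonneg fun i _ => binomialBelow_nonneg ha0 ha1 _ _
  · set g' := g - P.goodCount ε (h) - (if P.quantile h ∈ Set.Icc ε (1 - ε) then 1 else 0) with hg'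
    have h0 : ∀ j, g - P.goodCount ε (j :: h) = g' := fun j => by
      simp only [goodCount, hg']; omega
    set f : Fin n → ℝ := fun i => binomialBelow a M g' (P.load h i) with hf
    set e : Fin n → ℝ := fun i => binomialBelow a M g' (P.load h i + 1) with he
    have he0 : ∀ i, 0 ≤ e i := fun i => binomialBelow_nonneg ha0 ha1 _ _
    have hef : ∀ i, e i ≤ f i := fun i => binomialBelow_antitone ha0 ha1 _ (Nat.le_succ _)
    have h1 : ∀ j, Φ (j :: h) ≤ ∏ i, if i = j then e i else f i := fun j => by
      refine prod_le_prod (fun i _ => binomialBelow_nonneg ha0 ha1 _ _) fun i _ => ?_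
      rw [h0, load_cons]
      split_ifs with hij
      · exact binomialBelow_antitone ha0 ha1 _ (Nat.add_le_add_left (hw h hh j) _)
      · exact le_rfl
    have h2 : ∀ j, (∏ i, if i = j then e i else f i) ≤ ∏ i, f i := fun j => prod_le_prod
      (fun i _ => by split_ifs; exacts [he0 i, (he0 i).trans (hef i)])
      (fun i _ => by split_ifs; exacts [hef i, le_rfl])
    have h3 : ∑ j, P.binProb h j * Φ (j :: h) ≤
        ∑ j, P.binProb h j * ∏ i, if i = j then e i else f i :=
      sum_le_sum fun j _ => mul_le_mul_of_nonneg_left (h1 j) (P.binProb_nonneg h j)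
    refine h3.trans ?_
    by_cases hq : P.quantile h ∈ Set.Icc ε (1 - ε) ∧ P.goodCount ε h < g
    · have hg'' : g - P.goodCount ε h = g' + 1 := by
        rw [hg', if_pos hq.1]; have := hq.2; omega
      have h4 : Φ h = ∏ i, ((1 - a) * f i + a * e i) := by
        simp only [Φ, hg'', binomialBelow, hf, he]
      rw [h4]
      exact sum_mul_prod_le ha0 ha1 he0 hef (hgood h hh hq.1) (P.sum_binProb h)
    · have hg'' : g - P.goodCount ε h = g' := by
        rw [hg']
        split_ifs with hq'
        · have : ¬ P.goodCount ε h < g := fun hc => hq ⟨hq', hc⟩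
          omega
        · rfl
      have h4 : Φ h = ∏ i, f i := by simp only [Φ, hg'', hf]
      rw [h4]
      calc ∑ j, P.binProb h j * ∏ i, (if i = j then e i else f i)
          ≤ ∑ j, P.binProb h j * ∏ i, f i :=
            sum_le_sum fun j _ => mul_le_mul_of_nonneg_left (h2 j) (P.binProb_nonneg h j)
        _ = ∏ i, f i := by rw [← sum_mul, P.sum_binProb, one_mul]
  · have h1 : g - P.goodCount ε h = 0 := Nat.sub_eq_zero_of_le hh.2
    simp only [Φ, h1, binomialBelow]
    rw [prod_congr rfl fun i _ => if_pos (hh.1 i)]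
    simp
  · simp [Φ, goodCount, load, loadVec]

theorem total_le {wMinus t : ℕ} (hw : ∀ h, P.Possible h → ∀ i, P.weight h i ≤ wMinus)
    {h : List (Fin n)} (hh : h ∈ (P.law t).support) : P.total h ≤ wMinus * t := by
  induction t generalizing h with
  | zero =>
    have := P.length_of_mem_support_law hh
    rw [List.length_eq_zero_iff] at this
    subst this
    simp [total, load, loadVec]
  | succ t ih =>
    obtain ⟨i, h', rfl, h1⟩ := P.mem_support_law_succ hh
    rw [total_cons, Nat.mul_succ]
    exact add_le_add (ih h1) (hw h' ⟨t, h1⟩ i)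

end AllocationProcess

end

/-! ### Binomial tail estimates and growth of the logarithm -/

theorem exp_neg_two_mul_le {a : ℝ} (ha0 : 0 ≤ a) (ha : a ≤ 1 / 2) :
    Real.exp (-(2 * a)) ≤ 1 - a := by
  rw [Real.exp_neg, inv_le_comm₀ (Real.exp_pos _) (by linarith)]
  refine le_trans ?_ (Real.add_one_le_exp _)
  rw [inv_le_iff_one_le_mul₀ (by linarith)]
  nlinarith

/-- A lower bound for a binomial probability. -/
theorem rpow_mul_exp_le_choose_mul {g M : ℕ} {a ρ : ℝ} (hM : 1 ≤ M) (hMg : 2 * M ≤ g)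
    (ha0 : 0 ≤ a) (ha : a ≤ 1 / 2) (hρ0 : 0 ≤ ρ) (hρ : 2 * ρ * M ≤ g * a) :
    ρ ^ M * Real.exp (-(2 * a * g)) ≤ (g.choose M : ℝ) * a ^ M * (1 - a) ^ g := by
  have hM0 : (0 : ℝ) < M := by exact_mod_cast hM
  have h1 : Real.exp (-(2 * a * g)) ≤ (1 - a) ^ g := by
    calc Real.exp (-(2 * a * g)) = Real.exp (-(2 * a)) ^ g := by
          rw [← Real.exp_nat_mul]; congr 1; ring
      _ ≤ _ := pow_le_pow_left₀ (Real.exp_pos _).le (exp_neg_two_mul_le ha0 ha) g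
  have h2 : ρ ^ M ≤ (g.choose M : ℝ) * a ^ M := by
    have h3 := Nat.pow_le_choose (α := ℝ) M g
    have h4 : ((M.factorial : ℕ) : ℝ) ≤ (M : ℝ) ^ M := by exact_mod_cast Nat.factorial_le_pow M
    have h5 : (g : ℝ) / 2 ≤ ((g + 1 - M : ℕ) : ℝ) := by
      rw [Nat.cast_sub (by omega)]
      have : 2 * (M : ℝ) ≤ g := by exact_mod_cast hMg
      push_cast
      linarith
    have h6 : ((g : ℝ) / 2 / M) ^ M ≤ (g.choose M : ℝ) := by
      refine le_trans ?_ h3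
      rw [div_pow]
      have : (0 : ℝ) < M.factorial := by exact_mod_cast M.factorial_pos
      gcongr
    calc ρ ^ M ≤ ((g : ℝ) / 2 / M * a) ^ M := by
          refine pow_le_pow_left₀ hρ0 ?_ M
          rw [div_div, div_mul_eq_mul_div, le_div_iff₀ (by positivity)]
          linarith
      _ = ((g : ℝ) / 2 / M) ^ M * a ^ M := mul_pow _ _ _
      _ ≤ _ := by gcongr
  exact mul_le_mul h2 h1 (Real.exp_pos _).le (by positivity)

/-- With the expected number of balls in a bin a small multiple of `log n`, it is still likely
that one of `n` bins receives a large multiple of that number. -/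
theorem binomialBelow_pow_le {n g M : ℕ} {c ρ κ b : ℝ} (hn : 2 ≤ n) (hM : 1 ≤ M)
    (hMg : 2 * M ≤ g) (hc : c ∈ Set.Ioc (0 : ℝ) 1) (hρ0 : 0 < ρ) (hρ1 : ρ ≤ 1)
    (hρ : 2 * ρ * M ≤ g * (c / n)) (hMb : M ≤ 2 * b * κ * Real.log n)
    (hg : g ≤ κ * n * Real.log n) (hκ : κ * (2 * b * Real.log (1 / ρ) + 2) ≤ 1 / 2) :
    binomialBelow (c / n) M g 0 ^ n ≤ Real.exp (-Real.log n) := by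
  have hn0 : (2 : ℝ) ≤ n := by exact_mod_cast hn
  have ha0 : 0 ≤ c / n := div_nonneg hc.1.le (by linarith)
  have ha : c / n ≤ 1 / 2 := div_le_div₀ (by norm_num) hc.2 (by norm_num) hn0
  set L := Real.log n with hL
  have hL0 : 0 ≤ L := Real.log_nonneg (by linarith)
  have h1 := le_one_sub_binomialBelow ha0 (by linarith) g M 0 (zero_add M)
  have h2 := rpow_mul_exp_le_choose_mul hM hMg ha0 ha hρ0.le hρ
  have hlog : 0 ≤ Real.log (1 / ρ) := Real.log_nonneg (by rwa [le_div_iff₀ hρ0, one_mul])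
  -- The choice of `κ` makes one bin succeed with probability at least `n ^ (-1 / 2)`.
  have h3 : Real.exp (-(L / 2)) ≤ ρ ^ M * Real.exp (-(2 * (c / n) * g)) := by
    have h4 : ρ ^ M = Real.exp (-(M * Real.log (1 / ρ))) := by
      rw [one_div, Real.log_inv, mul_neg, neg_neg, Real.exp_nat_mul, Real.exp_log hρ0]
    rw [h4, ← Real.exp_add]
    refine Real.exp_le_exp.2 ?_
    have h5 : M * Real.log (1 / ρ) ≤ 2 * b * κ * L * Real.log (1 / ρ) := by gcongr
    have h6 : c / n * g ≤ κ * L := by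
      rw [div_mul_eq_mul_div, div_le_iff₀ (by linarith)]
      calc c * g ≤ 1 * g := by gcongr; exact hc.2
        _ ≤ _ := by linarith
    have h7 := mul_le_mul_of_nonneg_right hκ hL0
    linarith
  have h8 : binomialBelow (c / n) M g 0 ≤ 1 - Real.exp (-(L / 2)) := by linarith
  have h9 : 1 - Real.exp (-(L / 2)) ≤ Real.exp (-Real.exp (-(L / 2))) := by
    linarith [Real.add_one_le_exp (-Real.exp (-(L / 2)))]
  calc binomialBelow (c / n) M g 0 ^ n
      ≤ Real.exp (-Real.exp (-(L / 2))) ^ n :=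
        pow_le_pow_left₀ (binomialBelow_nonneg ha0 (by linarith) _ _) (h8.trans h9) n
    _ = Real.exp (-Real.exp (L / 2)) := by
        rw [← Real.exp_nat_mul]
        congr 1
        have : (n : ℝ) = Real.exp L := (Real.exp_log (by linarith)).symm
        rw [this, mul_neg, ← Real.exp_add]
        congr 2
        ring
    _ ≤ Real.exp (-L) := by
        refine Real.exp_le_exp.2 (neg_le_neg ?_)
        have := Real.quadratic_le_exp_of_nonneg (show 0 ≤ L / 2 by linarith)
        nlinarith [sq_nonneg (L / 2 - 2)]

theorem eventually_le_log (X : ℝ) : ∀ᶠ n : ℕ in Filter.atTop, X ≤ Real.log n :=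
  (Real.tendsto_log_atTop.comp tendsto_natCast_atTop_atTop).eventually_ge_atTop X

theorem eventually_mul_log_sq_le {X : ℝ} (hX : 0 < X) :
    ∀ᶠ n : ℕ in Filter.atTop, X * Real.log n ^ 2 ≤ n := by
  have h := (Real.isLittleO_pow_log_id_atTop (n := 2)).bound (inv_pos.2 hX)
  filter_upwards [tendsto_natCast_atTop_atTop.eventually h] with n hn
  simp only [norm_pow, Real.norm_eq_abs, sq_abs, id, abs_of_nonneg (Nat.cast_nonneg (α := ℝ) n)] at hn
  rwa [le_inv_mul_iff₀ hX] at hn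

namespace AllocationProcess

variable {n : ℕ} (P : AllocationProcess n)

theorem le_gap {h : List (Fin n)} (i : Fin n) :
    P.load h i - (P.total h : ℝ) / n ≤ P.gap h :=
  sub_le_sub_right (le_ciSup (f := fun i => (P.load h i : ℝ)) (Set.finite_range _).bddAbove i) _

end AllocationProcess

/-! ### Choice of constants and conclusion -/

theorem theorem3p2 (k₁ : ℕ) (k₂ k₃ k₄ : ℝ) (wPlus wMinus : ℕ) (c : ℝ → ℝ)
    (hk₁ : 1 ≤ k₁) (hk₂ : k₂ ∈ Set.Ioc (0 : ℝ) 1) (hk₃ : k₃ ∈ Set.Ioc (0 : ℝ) 1)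
    (hk₄ : k₄ ∈ Set.Ioc (0 : ℝ) 1)
    (hc : ∀ ε ∈ Set.Ioo (0 : ℝ) (1 / 2), c ε ∈ Set.Ioc (0 : ℝ) 1) :
    ∃ κ : ℝ, 0 < κ ∧ ∃ n₀ : ℕ, ∀ n ≥ n₀, ∀ P : AllocationProcess n,
      (P.CondP2 k₁ k₂ k₃ k₄ ∧ P.CondW1 wPlus wMinus ∨
        P.CondP1 k₁ k₂ ∧ P.CondW2 wPlus wMinus) →
      P.CondP3 c →
      1 - (n : ℝ) ^ (-(1 / 2) : ℝ) ≤
        P.pr ⌊κ * n * Real.log n⌋₊ {h | κ * Real.log n ≤ P.gap h} := by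
  -- Weight zero contradicts the weight condition, but that is only available once a process is
  -- given; the constants below need `1 ≤ wMinus` earlier.
  rcases Nat.eq_zero_or_pos wMinus with rfl | hw
  · refine ⟨1, one_pos, 0, fun n _ P hP _ => ?_⟩
    have hW : P.CondW1 wPlus 0 := hP.elim (fun h => h.2) (fun h => h.2.toCondW1)
    have := hW.one_le
    have := hW.le
    omega
  have hw1 : (1 : ℝ) ≤ wMinus := by exact_mod_cast hw
  obtain ⟨ε, hε, B, hB, C₀, hC₀, D, hD, n₁, hpot⟩ :=
    exists_potential hk₂ (lt_min hk₃.1 hk₄.1) hw1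
  have hcε := hc ε hε
  -- With a fraction `γ` of balanced rounds, the correction `(D + 1 / 2) * γ * T` is `T / 8`, half
  -- of the available decrease `T / 4`.
  set γ : ℝ := 1 / (8 * D + 4) with hγ
  have hγ0 : 0 < γ := by positivity
  have hγ1 : γ ≤ 1 / 4 := by
    rw [hγ]; exact one_div_le_one_div_of_le (by norm_num) (by linarith)
  have hγD : (D + 1 / 2) * γ = 1 / 8 := by rw [hγ]; field_simp; ring
  set b : ℝ := wMinus + 1 with hb
  have hb0 : 2 ≤ b := by linarith
  -- Lower bound for the binomial mean divided by `2 * M`. Both scale with `κ`, so `ρ` is free of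
  -- `κ`, which can be chosen afterwards.
  set ρ : ℝ := γ * c ε / (8 * b) with hρ
  have hρ0 : 0 < ρ := by have := hcε.1; positivity
  have hρ1 : ρ ≤ 1 := by
    rw [hρ, div_le_one (by linarith)]
    nlinarith [hcε.1, hcε.2]
  have hlog : 0 ≤ Real.log (1 / ρ) := Real.log_nonneg (by rwa [le_div_iff₀ hρ0, one_mul])
  obtain ⟨κ, hκ0, hκ⟩ : ∃ κ : ℝ, 0 < κ ∧ κ * (2 * b * Real.log (1 / ρ) + 2) = 1 / 2 :=
    ⟨1 / 2 / (2 * b * Real.log (1 / ρ) + 2), by positivity, by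
      have : 2 * b * Real.log (1 / ρ) + 2 ≠ 0 := by positivity
      field_simp⟩
  refine ⟨κ, hκ0, Filter.eventually_atTop.1 ?_⟩
  -- The thresholds serve, in order: the potential, `n ≥ 2`, `2 * M ≤ g`, the final `2 / n ≤ n ^ (-1
  -- / 2)`, the rounding of `M`, the initial potential against `T`, and the step size of order `M`
  -- against `T`.
  filter_upwards [Filter.eventually_ge_atTop n₁, Filter.eventually_ge_atTop 2,
    Filter.eventually_ge_atTop ⌈16 * b / γ⌉₊, eventually_le_log 2, eventually_le_log (1 / (b * κ)),
    eventually_le_log (16 * (C₀ + 2) / κ),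
    eventually_mul_log_sq_le (show 0 < 256 * B ^ 2 * b ^ 2 * κ by positivity)] with
    n hn₁ hn₂ hnb hL2 hLb hLC hnL P hP hP3
  have hn2 : (2 : ℝ) ≤ n := by exact_mod_cast hn₂
  have hn0 : (0 : ℝ) < n := by linarith
  have hnpos : 0 < n := by omega
  set L := Real.log n with hL
  have hL0 : 0 < L := by linarith
  rw [div_le_iff₀ (by positivity)] at hLb hLC
  rw [Nat.ceil_le, div_le_iff₀ hγ0] at hnb
  have hW : P.CondW1 wPlus wMinus := hP.elim (fun h => h.2) (fun h => h.2.toCondW1)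
  set T := ⌊κ * n * L⌋₊ with hT
  have hTle : (T : ℝ) ≤ κ * n * L := Nat.floor_le (by positivity)
  have hTge : κ * n * L - 1 ≤ T := (Nat.sub_one_lt_floor _).le
  have hκL : 32 ≤ κ * L := by linarith
  have hκnL : 64 ≤ κ * n * L := by nlinarith
  set M := ⌈b * κ * L⌉₊ with hM
  have hMge : b * κ * L ≤ M := Nat.le_ceil _
  have hMle : (M : ℝ) ≤ 2 * b * κ * L := by
    have := (Nat.ceil_lt_add_one (show 0 ≤ b * κ * L by positivity)).le
    linarith
  have hM1 : 1 ≤ M := Nat.ceil_pos.2 (by positivity)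
  set g := ⌈γ * T⌉₊ with hg
  have hgge : γ * T ≤ g := Nat.le_ceil _
  have hgle : (g : ℝ) ≤ γ * T + 1 := (Nat.ceil_lt_add_one (by positivity)).le
  have hstep : ∀ h, P.Possible h → BiasedStep (P.normLoad h) (P.binProb h)
      (fun i => (P.weight h i : ℝ)) wMinus k₂ (min k₃ k₄) := fun h hh => by
    rcases hP with ⟨h1, h2⟩ | ⟨h1, h2⟩
    · exact AllocationProcess.biasedStep_of_condP2 hnpos hk₃ hk₄ h1 h2 hh
    · exact AllocationProcess.biasedStep_of_condW2 hnpos ((min_le_left _ _).trans hk₃.2) h1 h2 hh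
  obtain ⟨F, hF, hF0, hFξ⟩ := hpot n hn₁
  have hA : P.pr T {h | (∀ i, P.load h i < M) ∧ (P.goodCount ε h : ℝ) < γ * T} ≤
      Real.exp (-L) := by
    refine (P.pr_goodCount_lt_le hB hM1 hF hF0 hD (fun h hh hload => ?_) T).trans ?_
    · obtain ⟨ξ, h1, h2, h3⟩ := hFξ _ _ _ M (by exact_mod_cast hM1) (hstep h hh)
        (P.abs_normLoad_le hload)
      refine ⟨ξ, fun i => ?_, h2, h3⟩
      have : P.normLoad (i :: h) = bump (P.normLoad h) i (P.weight h i) :=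
        funext fun j => P.normLoad_cons i h j
      rw [this]
      exact h1 i
    · refine Real.exp_le_exp.2 ?_
      have hBM : 0 < 4 * (B * M) ^ 2 := by
        have : (1 : ℝ) ≤ M := by exact_mod_cast hM1
        positivity
      have h1 : (C₀ + 1) * n - T / 4 + (D + 1 / 2) * (γ * T) ≤ -(κ * n * L / 16) := by
        rw [← mul_assoc, hγD]
        have h2 := mul_le_mul_of_nonneg_right hLC hn0.le
        linarith
      have h2 : 4 * (B * M) ^ 2 * L ≤ κ * n * L / 16 := by
        have h3 : (B * M) ^ 2 ≤ (B * (2 * b * κ * L)) ^ 2 := by gcongr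
        have h4 : κ * L * (256 * B ^ 2 * b ^ 2 * κ * L ^ 2) ≤ κ * L * n := by gcongr
        have h5 : 4 * (B * M) ^ 2 * L ≤ 4 * (B * (2 * b * κ * L)) ^ 2 * L := by gcongr
        linarith
      rw [one_div_mul_eq_div, div_le_iff₀ hBM]
      linarith
  have hTg : γ * (κ * n * L / 2) ≤ g := le_trans (by gcongr; linarith) hgge
  have hBev : P.pr T {h | (∀ i, P.load h i < M) ∧ g ≤ P.goodCount ε h} ≤ Real.exp (-L) := by
    have hc0 := hcε.1
    refine (P.pr_le_binomialBelow_pow (a := c ε / n) (by positivity) ?_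
      (fun h hh i => hW.one_le.trans (hW.weight_bounds hh i).1) (fun h hh hq i => ?_) T g).trans
      (binomialBelow_pow_le (κ := κ) (b := b) hn₂ hM1 ?_ hcε hρ0 hρ1 ?_ hMle ?_ hκ.le)
    · rw [div_le_one hn0]; linarith [hcε.2]
    · have := hP3 ε hε h hh hq ((P.order h).symm i)
      simpa [AllocationProcess.probVec] using this
    · have h1 := mul_le_mul_of_nonneg_right hnb (show 0 ≤ κ * L by positivity)
      have : 2 * (M : ℝ) ≤ g := by linarith
      exact_mod_cast this
    · calc 2 * ρ * M ≤ 2 * ρ * (2 * b * κ * L) := by gcongr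
        _ = γ * (κ * n * L / 2) * (c ε / n) := by rw [hρ]; field_simp; ring
        _ ≤ _ := by gcongr
    · have : γ * T ≤ 1 / 4 * T := by gcongr
      linarith
  have hcover : ∀ h ∈ (P.law T).support, h ∈ {h | κ * L ≤ P.gap h} ∨
      h ∈ {h | (∀ i, P.load h i < M) ∧ (P.goodCount ε h : ℝ) < γ * T} ∨
      h ∈ {h | (∀ i, P.load h i < M) ∧ g ≤ P.goodCount ε h} := fun h hh => by
    by_cases hload : ∀ i, P.load h i < M
    · rcases lt_or_ge (P.goodCount ε h : ℝ) (γ * T) with hlt | hge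
      · exact Or.inr (Or.inl ⟨hload, hlt⟩)
      · exact Or.inr (Or.inr ⟨hload, Nat.ceil_le.2 hge⟩)
    · left
      obtain ⟨i, hi⟩ := not_forall.1 hload
      have h1 : (M : ℝ) ≤ P.load h i := by exact_mod_cast not_lt.1 hi
      have h2 : (P.total h : ℝ) / n ≤ wMinus * (κ * L) := by
        rw [div_le_iff₀ hn0]
        have h3 : (P.total h : ℝ) ≤ wMinus * T := by
          exact_mod_cast P.total_le (fun h hh i => (hW.weight_bounds hh i).2) hh
        have h4 : (wMinus : ℝ) * T ≤ wMinus * (κ * n * L) := by gcongr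
        linarith
      refine le_trans ?_ (P.le_gap i)
      rw [hb] at hMge
      linarith
  have htotal := P.one_le_pr_add_pr_add_pr hcover
  have hfinal : 2 * Real.exp (-L) ≤ (n : ℝ) ^ (-(1 / 2) : ℝ) := by
    rw [Real.rpow_def_of_pos hn0, ← hL]
    have h1 : Real.exp (L * -(1 / 2)) = Real.exp (L / 2) * Real.exp (-L) := by
      rw [← Real.exp_add]; congr 1; ring
    rw [h1]
    have h2 := Real.add_one_le_exp (L / 2)
    have h3 := Real.exp_pos (-L)
    nlinarith
  linarith
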